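/- Let $n>2$, let $B^n$ be the open unit ball of $\mathbb{R}^n$, and let $\sigma$ be the surface measure on $\partial B^n$ normalized so that $\sigma(\partial B^n)=1$. For $a\in B^n$ let $$\phi_a(x)=\frac{a\,|x-a|^2+(1-|a|^2)(a-x)}{1-2\langle x,a\rangle+|x|^2|a|^2}$$ be the Moebius transformation of $B^n$ interchanging $0$ and $a$. A ($\mathbb{R}$- or $\mathbb{C}$-valued) function $f\in C^2(B^n)$ is called $H$-harmonic if $\Delta_h f(x):=\Delta(f\circ\phi_x)(0)=0$ for all $x\in B^n$. The Hardy space $\mathcal{H}^2_h(B^n)$ consists of the $H$-harmonic functions $f$ on $B^n$ with $$\sup_{0<r<1}\Big(\int_{\partial B^n}|f(r\eta)|^2\,d\sigma(\eta)\Big)^{1/2}<\infty .$$ Its reproducing kernel, the Szegő kernel, is the function $K_h$ on $B^n\times B^n$ which is $H$-harmonic in both variables, satisfies $K_h(x,\cdot)\in\mathcal{H}^2_h(B^n)$ for every $x\in B^n$, and has the reproducing property $$f(x)=\lim_{r\to1^-}\int_{\partial B^n}f(r\eta)\,K_h(x,r\eta)\,d\sigma(\eta)\qquad\text{for all }x\in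 B^n,\ f\in\mathcal{H}^2_h(B^n).$$ Such a kernel exists, is unique, and is given for all $x,y\in B^n$ by $$K_h(x,y)=\frac{(1-|x|^2)^{n-1}(1-|y|^2)^{n-1}}{(1+|x|^2)^{n-1}(1+|y|^2)^{n-1}}\;X_9\bigl(n-1,\,n-1;\,\tfrac n2;\,X,Y,Z\bigr),$$ where $$X=\Big(\frac{|x|}{1+|x|^2}\Big)^2,\qquad Y=\frac{2\langle x,y\rangle}{(1+|x|^2)(1+|y|^2)},\qquad Z=\Big(\frac{|y|}{1+|y|^2}\Big)^2,$$ $$X_9(\alpha,\beta;\gamma;x,y,z)=\sum_{p=0}^\infty\sum_{q=0}^\infty\sum_{l=0}^\infty\frac{(\alpha)_{2p+q}\,(\beta)_{2l+q}}{(\gamma)_{p+q+l}\;p!\,q!\,l!}\,x^p y^q z^l$$ is Exton's triple hypergeometric series, $(a)_m=a(a+1)\cdots(a+m-1)$ is the Pochhammer symbol, and the triple series converges absolutely at these arguments. -/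

import Mathlib

open MeasureTheory Metric Set Filter Topology
open scoped ENNReal

noncomputable section

/-- The Moebius transformation `φ_a` of the unit ball of `ℝⁿ` that interchanges `0` and `a`. -/
def moebiusMap {n : ℕ} (a x : EuclideanSpace ℝ (Fin n)) : EuclideanSpace ℝ (Fin n) :=
  (1 - 2 * inner ℝ x a + ‖x‖ ^ 2 * ‖a‖ ^ 2)⁻¹ • (‖x - a‖ ^ 2 • a + (1 - ‖a‖ ^ 2) • (a - x))

/-- The hyperbolic Laplacian `(Δ_h f)(x) = Δ (f ∘ φ_x) (0)`. -/
def hyperbolicLaplacian {𝕜 : Type*} [RCLike 𝕜] {n : ℕ}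
    (f : EuclideanSpace ℝ (Fin n) → 𝕜) (x : EuclideanSpace ℝ (Fin n)) : 𝕜 :=
  Laplacian.laplacian (fun u : EuclideanSpace ℝ (Fin n) => f (moebiusMap x u)) 0

/-- `f` is `H`-harmonic on the unit ball: of class `C²` there and annihilated by `Δ_h`.
Values of `f` outside the open unit ball play no role. -/
structure IsHHarmonic {𝕜 : Type*} [RCLike 𝕜] {n : ℕ}
    (f : EuclideanSpace ℝ (Fin n) → 𝕜) : Prop where
  contDiffOn : ContDiffOn ℝ 2 f (ball 0 1)
  laplacian_eq_zero : ∀ x ∈ ball (0 : EuclideanSpace ℝ (Fin n)) 1, hyperbolicLaplacian f x = 0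

/-- The surface measure on the unit sphere of `ℝⁿ`, normalized to have total mass one. -/
def normalizedSphereMeasure (n : ℕ) : Measure (sphere (0 : EuclideanSpace ℝ (Fin n)) 1) :=
  ((volume : Measure (EuclideanSpace ℝ (Fin n))).toSphere univ)⁻¹ •
    (volume : Measure (EuclideanSpace ℝ (Fin n))).toSphere

/-- `‖f‖_{𝓗^p}`, the supremum over `0 < r < 1` of the `L^p` norms of `η ↦ f (r η)` on the
sphere, as an extended nonnegative real. -/
def hardyNorm {𝕜 : Type*} [RCLike 𝕜] {n : ℕ} (p : ℝ≥0∞)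
    (f : EuclideanSpace ℝ (Fin n) → 𝕜) : ℝ≥0∞ :=
  ⨆ r ∈ Ioo (0 : ℝ) 1,
    eLpNorm (fun η : sphere (0 : EuclideanSpace ℝ (Fin n)) 1 =>
      f (r • (η : EuclideanSpace ℝ (Fin n)))) p (normalizedSphereMeasure n)

/-- Membership in the `H`-harmonic Hardy space `𝓗^p_h(Bⁿ)`. -/
structure MemHHardy {𝕜 : Type*} [RCLike 𝕜] {n : ℕ} (p : ℝ≥0∞)
    (f : EuclideanSpace ℝ (Fin n) → 𝕜) : Prop where
  isHHarmonic : IsHHarmonic f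
  hardyNorm_lt_top : hardyNorm p f < ∞

/-- `K` is a Szegő kernel, i.e. a reproducing kernel of the Hardy space `𝓗²_h(Bⁿ)`: each
`K(x, ·)` lies in the space, `K` is `H`-harmonic in both variables, and
`f(x) = lim_{r → 1⁻} ∫ f(rη) K(x, rη) dσ(η)` for all `f` in the space and all `x` in the ball.
Only the values of `K` on `Bⁿ × Bⁿ` matter. -/
structure IsSzegoKernel {𝕜 : Type*} [RCLike 𝕜] {n : ℕ}
    (K : EuclideanSpace ℝ (Fin n) → EuclideanSpace ℝ (Fin n) → 𝕜) : Prop where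
  memHHardy : ∀ x ∈ ball (0 : EuclideanSpace ℝ (Fin n)) 1, MemHHardy 2 (K x)
  isHHarmonic_left : ∀ y ∈ ball (0 : EuclideanSpace ℝ (Fin n)) 1,
    IsHHarmonic (fun x => K x y)
  reproducing : ∀ f : EuclideanSpace ℝ (Fin n) → 𝕜, MemHHardy 2 f →
    ∀ x ∈ ball (0 : EuclideanSpace ℝ (Fin n)) 1,
      Tendsto (fun r : ℝ => ∫ η : sphere (0 : EuclideanSpace ℝ (Fin n)) 1,
          f (r • (η : EuclideanSpace ℝ (Fin n))) * K x (r • (η : EuclideanSpace ℝ (Fin n)))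
            ∂(normalizedSphereMeasure n))
        (𝓝[<] 1) (𝓝 (f x))

/-- The Pochhammer symbol `(a)_m = a (a + 1) ⋯ (a + m - 1)`. -/
def pochhammerSymbol (a : ℝ) (m : ℕ) : ℝ := (ascPochhammer ℝ m).eval a

/-- The term with index `(p, q, l)` of Exton's triple series `X₉`. -/
def extonX9Term (α β γ x y z : ℝ) (p q l : ℕ) : ℝ :=
  pochhammerSymbol α (2 * p + q) * pochhammerSymbol β (2 * l + q) /
    (pochhammerSymbol γ (p + q + l) * p.factorial * q.factorial * l.factorial) *
    x ^ p * y ^ q * z ^ l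

/-- Exton's triple hypergeometric series `X₉(α, β; γ; x, y, z)`. -/
def extonX9 (α β γ x y z : ℝ) : ℝ :=
  ∑' p : ℕ, ∑' q : ℕ, ∑' l : ℕ, extonX9Term α β γ x y z p q l

end

/-! The kernel is K(x,y) = ∫ P(x,ζ)P(y,ζ) dσ(ζ) with P(x,ζ) = ((1-|x|²)/|x-ζ|²)^(n-1), the Poisson
kernel of Δ_h. Three facts about this integral give the theorem.

It is H-harmonic in each variable. By the cocycle law P(φ_a(u),ζ) = P(a,ζ)·P(u,φ_a(ζ))
(`hPoisson_moebiusMap`), it suffices to compute one ordinary Laplacian at the origin, which vanishes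
exactly because the exponent is n-1; differentiation under the integral does the rest.

It reproduces. For H-harmonic f write f_r(η) = f(rη), and P_r for Poisson integration evaluated at
radius r. Then P_s f_r = P_r f_s (`IsHHarmonic.integral_smul_mul_hPoisson_comm`): for f = P(·,ω)
this is a symmetry of K under the reflection exchanging two points of the sphere, and the general
case follows because the functions P(R·,ω) span a dense subspace of C(S) and the maximum principle
carries uniform approximation on |x| = R inwards. Fubini turns ∫ f(rη)K(sξ,rη) dσ(η) into P_r(P_r
f_s)(ξ), which tends to f(sξ) because P_r is an approximate identity. Two reproducing kernels, each
tested on a slice of the other, must agree up to exchanging the variables, so every Szegő kernel is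
this one.

It has the stated expansion. With u = 2x/(1+|x|²) and v = 2y/(1+|y|²), one has |x-ζ|² =
(1+|x|²)(1-⟨u,ζ⟩), so P(x,ζ) is a negative binomial series in ⟨u,ζ⟩. The product of two such series
integrates to the moments ∫⟨u,ζ⟩^j⟨v,ζ⟩^k, which rotation invariance evaluates as finite sums
(`sphereMoment_eq`). These are the blocks 2p+q = j, 2l+q = k of Exton's series. -/

/-! ### Laplacians at the origin of powers of a quotient -/

theorem deriv_deriv_line_eq_fderiv {E : Type*} [NormedAddCommGroup E] [NormedSpace ℝ E]
    {g : E → ℝ} (hg : ContDiffAt ℝ 2 g 0) (e : E) :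
    deriv (deriv fun t : ℝ => g (t • e)) 0 = fderiv ℝ (fderiv ℝ g) 0 e e := by
  have hline : ∀ t : ℝ, HasDerivAt (fun t : ℝ => t • e) e t := fun t => by
    simpa using (hasDerivAt_id t).smul_const e
  have hev : ∀ᶠ x in 𝓝 (0 : E), DifferentiableAt ℝ g x := by
    filter_upwards [hg.eventually (by simp)] with x hx using hx.differentiableAt (by simp)
  have h1 : (deriv fun t : ℝ => g (t • e)) =ᶠ[𝓝 0] fun t => fderiv ℝ g (t • e) e := by
    have : Tendsto (fun t : ℝ => t • e) (𝓝 0) (𝓝 0) := by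
      simpa using (hline 0).continuousAt.tendsto
    filter_upwards [this.eventually hev] with t ht
    exact (ht.hasFDerivAt.comp_hasDerivAt t (hline t)).deriv
  rw [h1.deriv_eq]
  have h2 : HasFDerivAt (fderiv ℝ g) (fderiv ℝ (fderiv ℝ g) 0) ((0 : ℝ) • e) := by
    rw [zero_smul]
    exact ((hg.fderiv_right (m := 1) le_rfl).differentiableAt (by simp)).hasFDerivAt
  have h3 : HasDerivAt (fun t : ℝ => fderiv ℝ g (t • e)) (fderiv ℝ (fderiv ℝ g) 0 e) 0 :=
    h2.comp_hasDerivAt (f := fun t : ℝ => t • e) 0 (hline 0)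
  exact ((ContinuousLinearMap.apply ℝ ℝ e).hasFDerivAt.comp_hasDerivAt (0 : ℝ) h3).deriv

/-- At the origin the Laplacian is the sum of the second derivatives along the coordinate lines. -/
theorem laplacian_zero_eq_sum_deriv {n : ℕ} {g : EuclideanSpace ℝ (Fin n) → ℝ}
    (hg : ContDiffAt ℝ 2 g 0) :
    Laplacian.laplacian g 0 =
      ∑ i, deriv (deriv fun t : ℝ => g (t • EuclideanSpace.basisFun (Fin n) ℝ i)) 0 := by
  rw [InnerProductSpace.laplacian_eq_iteratedFDeriv_orthonormalBasis g
    (EuclideanSpace.basisFun (Fin n) ℝ)]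
  refine Finset.sum_congr rfl fun i _ => ?_
  rw [iteratedFDeriv_two_apply, deriv_deriv_line_eq_fderiv hg]
  rfl

/-- The quotient `(1 - |u|²) / (1 - 2⟨b, u⟩ + s|u|²)`. -/
noncomputable def ballQuotient {n : ℕ} (b : EuclideanSpace ℝ (Fin n)) (s : ℝ)
    (u : EuclideanSpace ℝ (Fin n)) : ℝ :=
  (1 - ‖u‖ ^ 2) / (1 - 2 * inner ℝ b u + s * ‖u‖ ^ 2)

theorem contDiffAt_ballQuotient {n : ℕ} (b : EuclideanSpace ℝ (Fin n)) (s : ℝ) :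
    ContDiffAt ℝ 2 (ballQuotient b s) 0 := by
  unfold ballQuotient
  refine ContDiffAt.div ?_ ?_ (by simp)
  · exact (contDiff_const.sub (contDiff_norm_sq ℝ)).contDiffAt
  · exact ((contDiff_const.sub (contDiff_const.mul (contDiff_const.inner ℝ contDiff_id))).add
      (contDiff_const.mul (contDiff_norm_sq ℝ))).contDiffAt

/-- The quotient expands as 1 + 2ct + (4c²-1-s)t² + ⋯, so its k-th power has second derivative
k(k-1)(2c)² + k(8c²-2-2s) at 0. -/
theorem deriv_deriv_quotient_pow (c s : ℝ) (k : ℕ) :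
    deriv (deriv fun t : ℝ => ((1 - t ^ 2) / (1 - 2 * c * t + s * t ^ 2)) ^ k) 0 =
      4 * k * (k + 1) * c ^ 2 - 2 * k * (1 + s) := by
  set D : ℝ → ℝ := fun t => 1 - 2 * c * t + s * t ^ 2 with hD
  have hDd : ∀ t, HasDerivAt D (-(2 * c) + 2 * s * t) t := fun t => by
    have := (((hasDerivAt_id t).const_mul (2 * c)).const_sub 1).add
      (((hasDerivAt_id t).pow 2).const_mul s)
    refine this.congr_deriv ?_
    simp
    ring
  have hN : ∀ t : ℝ, HasDerivAt (fun t : ℝ => 1 - t ^ 2) (-(2 * t)) t := fun t => by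
    simpa using ((hasDerivAt_id t).pow 2).const_sub 1
  have hD0 : D 0 = 1 := by simp [hD]
  have hne : ∀ᶠ t in 𝓝 (0 : ℝ), D t ≠ 0 :=
    (hDd 0).continuousAt.eventually_ne (by rw [hD0]; norm_num)
  set q : ℝ → ℝ := fun t => (1 - t ^ 2) / D t with hq
  set q' : ℝ → ℝ := fun t => (-(2 * t) * D t - (1 - t ^ 2) * (-(2 * c) + 2 * s * t)) / D t ^ 2
    with hq'
  have hqd : ∀ t, D t ≠ 0 → HasDerivAt q (q' t) t := fun t ht => (hN t).div (hDd t) ht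
  have h1 : (deriv fun t => q t ^ k) =ᶠ[𝓝 0] fun t => k * q t ^ (k - 1) * q' t := by
    filter_upwards [hne] with t ht
    exact ((hqd t ht).pow k).deriv
  have hq0 : q 0 = 1 := by simp [hq, hD0]
  have hq'0 : q' 0 = 2 * c := by simp [hq', hD0]
  have h2 : HasDerivAt q' (8 * c ^ 2 - 2 - 2 * s) 0 := by
    have hnum : HasDerivAt
        (fun t : ℝ => -(2 * t) * D t - (1 - t ^ 2) * (-(2 * c) + 2 * s * t)) (-2 - 2 * s) 0 := by
      have ha : HasDerivAt (fun t : ℝ => -(2 * t)) (-2) 0 := by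
        exact ((hasDerivAt_id (0 : ℝ)).const_mul 2).neg.congr_deriv (by norm_num)
      have hb : HasDerivAt (fun t : ℝ => -(2 * c) + 2 * s * t) (2 * s) 0 := by
        simpa using ((hasDerivAt_id (0 : ℝ)).const_mul (2 * s)).const_add (-(2 * c))
      refine ((ha.mul (hDd 0)).sub ((hN 0).mul hb)).congr_deriv ?_
      simp only [hD0]
      ring
    refine (hnum.div ((hDd 0).pow 2) (by rw [Pi.pow_apply, hD0]; norm_num)).congr_deriv ?_
    simp only [Pi.pow_apply, hD0]
    norm_num
    ring
  rw [h1.deriv_eq]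
  have h3 := (((hqd 0 (by rw [hD0]; norm_num)).pow (k - 1)).const_mul (k : ℝ)).mul h2
  refine (h3.deriv).trans ?_
  simp only [Pi.pow_apply, hq0, hq'0, one_pow]
  -- The truncated exponent k - 1 is harmless at k = 0, where its coefficient vanishes.
  rcases k with _ | k
  · simp
  · push_cast [Nat.add_sub_cancel]
    ring

theorem laplacian_ballQuotient_pow {n : ℕ} (b : EuclideanSpace ℝ (Fin n)) (s : ℝ) (k : ℕ) :
    Laplacian.laplacian (fun u => ballQuotient b s u ^ k) 0 =
      4 * k * (k + 1) * ‖b‖ ^ 2 - 2 * k * n * (1 + s) := by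
  rw [laplacian_zero_eq_sum_deriv ((contDiffAt_ballQuotient b s).pow k)]
  have h : ∀ i, (fun t : ℝ => ballQuotient b s (t • EuclideanSpace.basisFun (Fin n) ℝ i) ^ k) =
      fun t : ℝ => ((1 - t ^ 2) / (1 - 2 * b i * t + s * t ^ 2)) ^ k := fun i => by
    funext t
    simp only [ballQuotient, norm_smul, inner_smul_right, EuclideanSpace.basisFun_apply,
      PiLp.norm_single, EuclideanSpace.inner_single_right]
    simp
    ring
  simp only [h, deriv_deriv_quotient_pow]
  rw [Finset.sum_sub_distrib, ← Finset.mul_sum, EuclideanSpace.real_norm_sq_eq]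
  simp
  ring

/-! ### The Poisson kernel and its behaviour under Moebius maps -/

/-- The Poisson kernel of the hyperbolic Laplacian of the unit ball. -/
noncomputable def hPoisson {n : ℕ} (x ζ : EuclideanSpace ℝ (Fin n)) : ℝ :=
  ((1 - ‖x‖ ^ 2) / ‖x - ζ‖ ^ 2) ^ (n - 1)

@[simp]
theorem moebiusMap_zero {n : ℕ} (a : EuclideanSpace ℝ (Fin n)) : moebiusMap a 0 = a := by
  simp [moebiusMap, ← add_smul]

/-- The denominator of the Moebius map. -/
noncomputable def moebiusDenom {n : ℕ} (a u : EuclideanSpace ℝ (Fin n)) : ℝ :=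
  1 - 2 * inner ℝ a u + ‖a‖ ^ 2 * ‖u‖ ^ 2

theorem moebiusMap_eq {n : ℕ} (a u : EuclideanSpace ℝ (Fin n)) :
    moebiusMap a u =
      (moebiusDenom a u)⁻¹ • (‖u - a‖ ^ 2 • a + (1 - ‖a‖ ^ 2) • (a - u)) := by
  rw [moebiusMap, moebiusDenom, real_inner_comm, mul_comm (‖u‖ ^ 2)]

theorem contDiff_moebiusDenom {n : ℕ} (a : EuclideanSpace ℝ (Fin n)) :
    ContDiff ℝ 2 (moebiusDenom a) :=
  (contDiff_const.sub (contDiff_const.mul (contDiff_const.inner ℝ contDiff_id))).add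
    (contDiff_const.mul (contDiff_norm_sq ℝ))

theorem eventually_moebiusDenom_ne_zero {n : ℕ} (a : EuclideanSpace ℝ (Fin n)) :
    ∀ᶠ u in 𝓝 0, moebiusDenom a u ≠ 0 :=
  (contDiff_moebiusDenom a).continuous.continuousAt.eventually_ne (by simp [moebiusDenom])

theorem contDiffAt_moebiusMap {n : ℕ} (a : EuclideanSpace ℝ (Fin n)) :
    ContDiffAt ℝ 2 (moebiusMap a) 0 := by
  rw [show moebiusMap a = _ from funext (moebiusMap_eq a)]
  have h : ContDiff ℝ 2 fun u : EuclideanSpace ℝ (Fin n) =>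
      ‖u - a‖ ^ 2 • a + (1 - ‖a‖ ^ 2) • (a - u) :=
    (((contDiff_norm_sq ℝ).comp (contDiff_id.sub contDiff_const)).smul contDiff_const).add
      (by fun_prop)
  exact ContDiffAt.smul (ContDiffAt.inv (contDiff_moebiusDenom a).contDiffAt
    (by simp [moebiusDenom])) h.contDiffAt

theorem ContDiffOn.contDiffAt_comp_moebiusMap {n : ℕ} {F : Type*} [NormedAddCommGroup F]
    [NormedSpace ℝ F] {f : EuclideanSpace ℝ (Fin n) → F} (hf : ContDiffOn ℝ 2 f (ball 0 1))
    {x : EuclideanSpace ℝ (Fin n)} (hx : x ∈ ball (0 : EuclideanSpace ℝ (Fin n)) 1) :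
    ContDiffAt ℝ 2 (fun u => f (moebiusMap x u)) 0 := by
  refine ContDiffAt.comp (0 : EuclideanSpace ℝ (Fin n)) ?_ (contDiffAt_moebiusMap x)
  rw [moebiusMap_zero]
  exact hf.contDiffAt (isOpen_ball.mem_nhds hx)

theorem one_sub_norm_moebiusMap_sq {n : ℕ} (a u : EuclideanSpace ℝ (Fin n))
    (h : moebiusDenom a u ≠ 0) :
    1 - ‖moebiusMap a u‖ ^ 2 = (1 - ‖a‖ ^ 2) * ballQuotient a (‖a‖ ^ 2) u := by
  have hb : ballQuotient a (‖a‖ ^ 2) u = (1 - ‖u‖ ^ 2) / moebiusDenom a u := rfl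
  rw [hb, moebiusMap_eq, norm_smul, mul_pow, norm_add_sq_real, norm_smul, norm_smul,
    inner_smul_left, inner_smul_right, inner_sub_right, real_inner_self_eq_norm_sq, mul_pow, mul_pow]
  simp only [Real.norm_eq_abs, sq_abs, norm_sub_sq_real, real_inner_comm a u, conj_trivial]
  field_simp
  rw [moebiusDenom]
  ring

theorem norm_moebiusMap_sub_sq {n : ℕ} (a u ζ : EuclideanSpace ℝ (Fin n)) (hζ : ‖ζ‖ = 1)
    (h : moebiusDenom a u ≠ 0) :
    ‖moebiusMap a u - ζ‖ ^ 2 = (moebiusDenom a u)⁻¹ * (‖a - ζ‖ ^ 2 * (1 + ‖u‖ ^ 2) -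
      2 * (2 * (1 - inner ℝ a ζ) * inner ℝ a u - (1 - ‖a‖ ^ 2) * inner ℝ u ζ)) := by
  have h1 := one_sub_norm_moebiusMap_sq a u h
  have hb : ballQuotient a (‖a‖ ^ 2) u = (1 - ‖u‖ ^ 2) / moebiusDenom a u := rfl
  rw [hb] at h1
  rw [norm_sub_sq_real, show ‖moebiusMap a u‖ ^ 2 = 1 - (1 - ‖a‖ ^ 2) *
    ((1 - ‖u‖ ^ 2) / moebiusDenom a u) by linarith, moebiusMap_eq, inner_smul_left,
    inner_add_left, inner_smul_left, inner_smul_left, inner_sub_left]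
  simp only [norm_sub_sq_real, real_inner_comm a u, conj_trivial, hζ]
  field_simp
  rw [moebiusDenom]
  ring

/-- The image of `ζ` under the Moebius map `φ_a`, for a unit vector `ζ`. -/
noncomputable def moebiusBoundary {n : ℕ} (a ζ : EuclideanSpace ℝ (Fin n)) :
    EuclideanSpace ℝ (Fin n) :=
  (‖a - ζ‖ ^ 2)⁻¹ • ((2 * (1 - inner ℝ a ζ)) • a - (1 - ‖a‖ ^ 2) • ζ)

theorem sub_ne_zero_of_norm_lt {n : ℕ} {a ζ : EuclideanSpace ℝ (Fin n)} (ha : ‖a‖ < 1)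
    (hζ : ‖ζ‖ = 1) : ‖a - ζ‖ ≠ 0 := by
  intro h
  rw [norm_eq_zero, sub_eq_zero] at h
  rw [h] at ha
  linarith

theorem norm_moebiusBoundary {n : ℕ} {a ζ : EuclideanSpace ℝ (Fin n)} (ha : ‖a‖ < 1)
    (hζ : ‖ζ‖ = 1) : ‖moebiusBoundary a ζ‖ ^ 2 = 1 := by
  have hne := sub_ne_zero_of_norm_lt ha hζ
  have h2 : ‖a - ζ‖ ^ 2 = ‖a‖ ^ 2 - 2 * inner ℝ a ζ + 1 := by rw [norm_sub_sq_real, hζ]; ring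
  have h2' : ‖a - ζ‖ ^ 2 ≠ 0 := pow_ne_zero 2 hne
  rw [moebiusBoundary, norm_smul, mul_pow, h2, norm_sub_sq_real, norm_smul, norm_smul,
    inner_smul_left, inner_smul_right]
  rw [h2] at h2'
  simp only [norm_inv, Real.norm_eq_abs, mul_pow, sq_abs, conj_trivial, hζ, inv_pow]
  field_simp
  ring

/-- The cocycle law: b = `moebiusBoundary a ζ` is a unit vector, so the denominator of `ballQuotient
b 1` is |u-b|² and the last factor is the Poisson kernel P(u,b). Composition with φ_a only moves the
pole and multiplies by a constant. -/
theorem hPoisson_moebiusMap {n : ℕ} {a ζ : EuclideanSpace ℝ (Fin n)} (ha : ‖a‖ < 1)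
    (hζ : ‖ζ‖ = 1) {u : EuclideanSpace ℝ (Fin n)} (h : moebiusDenom a u ≠ 0) :
    hPoisson (moebiusMap a u) ζ =
      hPoisson a ζ * ballQuotient (moebiusBoundary a ζ) 1 u ^ (n - 1) := by
  have hne : ‖a - ζ‖ ^ 2 ≠ 0 := pow_ne_zero 2 (sub_ne_zero_of_norm_lt ha hζ)
  rw [hPoisson, hPoisson, ← mul_pow, one_sub_norm_moebiusMap_sq a u h,
    norm_moebiusMap_sub_sq a u ζ hζ h]
  congr 1
  have h1 : ‖a - ζ‖ ^ 2 * (1 + ‖u‖ ^ 2) -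
      2 * (2 * (1 - inner ℝ a ζ) * inner ℝ a u - (1 - ‖a‖ ^ 2) * inner ℝ u ζ) =
      ‖a - ζ‖ ^ 2 * (1 - 2 * inner ℝ (moebiusBoundary a ζ) u + 1 * ‖u‖ ^ 2) := by
    rw [moebiusBoundary, inner_smul_left, inner_sub_left, inner_smul_left, inner_smul_left,
      real_inner_comm u ζ]
    simp only [conj_trivial]
    generalize ‖a - ζ‖ ^ 2 = A at hne
    field_simp
    ring
  rw [h1]
  have hb : ballQuotient a (‖a‖ ^ 2) u = (1 - ‖u‖ ^ 2) / moebiusDenom a u := rfl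
  rw [hb, ballQuotient, mul_div_assoc', div_mul_div_comm, mul_comm (_)⁻¹, ← div_eq_mul_inv,
    div_div_div_cancel_right₀ h]

theorem contDiffOn_hPoisson {n : ℕ} {ζ : EuclideanSpace ℝ (Fin n)} (hζ : ‖ζ‖ = 1) :
    ContDiffOn ℝ 2 (fun x => hPoisson x ζ) (ball 0 1) := by
  refine ContDiffOn.pow (ContDiffOn.div ?_ ?_ fun x hx => ?_) _
  · exact (contDiff_const.sub (contDiff_norm_sq ℝ)).contDiffOn
  · exact ((contDiff_norm_sq ℝ).comp (contDiff_id.sub contDiff_const)).contDiffOn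
  · exact pow_ne_zero 2 (sub_ne_zero_of_norm_lt (mem_ball_zero_iff.mp hx) hζ)

/-- This is where the exponent n-1 is forced: for |b| = s = 1 the Laplacian is 4k(k+1) - 4kn. -/
theorem laplacian_ballQuotient_pow_eq_zero {n : ℕ} (hn : 0 < n) {b : EuclideanSpace ℝ (Fin n)}
    (hb : ‖b‖ ^ 2 = 1) :
    Laplacian.laplacian (fun u => ballQuotient b 1 u ^ (n - 1)) 0 = 0 := by
  rw [laplacian_ballQuotient_pow, hb, Nat.cast_pred hn]
  ring

theorem isHHarmonic_hPoisson {n : ℕ} (hn : 0 < n) {ζ : EuclideanSpace ℝ (Fin n)}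
    (hζ : ‖ζ‖ = 1) : IsHHarmonic (fun x => hPoisson x ζ) where
  contDiffOn := contDiffOn_hPoisson hζ
  laplacian_eq_zero x hx := by
    have hx' := mem_ball_zero_iff.mp hx
    have h : (fun u => hPoisson (moebiusMap x u) ζ) =ᶠ[𝓝 0]
        hPoisson x ζ • fun u => ballQuotient (moebiusBoundary x ζ) 1 u ^ (n - 1) := by
      filter_upwards [eventually_moebiusDenom_ne_zero x] with u hu
      exact hPoisson_moebiusMap hx' hζ hu
    rw [hyperbolicLaplacian, (InnerProductSpace.laplacian_congr_nhds h).eq_of_nhds,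
      InnerProductSpace.laplacian_smul _ ((contDiffAt_ballQuotient _ _).pow _),
      laplacian_ballQuotient_pow_eq_zero hn (norm_moebiusBoundary hx' hζ), smul_zero]

theorem hPoisson_smul_comm {n : ℕ} {η ζ : EuclideanSpace ℝ (Fin n)} (hη : ‖η‖ = 1)
    (hζ : ‖ζ‖ = 1) (r : ℝ) : hPoisson (r • η) ζ = hPoisson (r • ζ) η := by
  have : ‖r • η - ζ‖ ^ 2 = ‖r • ζ - η‖ ^ 2 := by
    rw [norm_sub_sq_real, norm_sub_sq_real, inner_smul_left, inner_smul_left, norm_smul, norm_smul,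
      hη, hζ, real_inner_comm]
  rw [hPoisson, hPoisson, this, norm_smul, norm_smul, hη, hζ]

theorem hPoisson_nonneg {n : ℕ} {x : EuclideanSpace ℝ (Fin n)} (hx : ‖x‖ ≤ 1)
    (ζ : EuclideanSpace ℝ (Fin n)) : 0 ≤ hPoisson x ζ := by
  have : ‖x‖ ^ 2 ≤ 1 := pow_le_one₀ (norm_nonneg x) hx
  exact pow_nonneg (div_nonneg (by linarith) (by positivity)) _

theorem hPoisson_map {n : ℕ} (e : EuclideanSpace ℝ (Fin n) ≃ₗᵢ[ℝ] EuclideanSpace ℝ (Fin n))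
    (x ζ : EuclideanSpace ℝ (Fin n)) : hPoisson (e x) (e ζ) = hPoisson x ζ := by
  rw [hPoisson, hPoisson, ← map_sub, e.norm_map, e.norm_map]

/-! ### Maximum principle -/

/-- A positive second derivative would make the point a local minimum as well, so the function would
be locally constant and its second derivative zero. -/
theorem IsLocalMax.deriv_deriv_nonpos {h : ℝ → ℝ} {a : ℝ} (hm : IsLocalMax h a)
    (hc : ContinuousAt h a) : deriv (deriv h) a ≤ 0 := by
  by_contra! hpos
  have hmin := isLocalMin_of_deriv_deriv_pos hpos hm.deriv_eq_zero hc
  have hconst : h =ᶠ[𝓝 a] fun _ => h a := by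
    filter_upwards [hm, hmin] with t h1 h2 using le_antisymm h1 h2
  have h1 : deriv h =ᶠ[𝓝 a] fun _ => 0 := by
    simpa using hconst.deriv
  rw [h1.deriv_eq] at hpos
  simp at hpos

theorem IsLocalMax.laplacian_zero_nonpos {n : ℕ} {g : EuclideanSpace ℝ (Fin n) → ℝ}
    (hm : IsLocalMax g 0) (hg : ContDiffAt ℝ 2 g 0) : Laplacian.laplacian g 0 ≤ 0 := by
  rw [laplacian_zero_eq_sum_deriv hg]
  refine Finset.sum_nonpos fun i _ => IsLocalMax.deriv_deriv_nonpos ?_ ?_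
  · refine IsLocalMax.comp_continuous (b := (0 : ℝ)) (g := fun t : ℝ => t • _) ?_ ?_
    · rwa [zero_smul]
    · fun_prop
  · refine ContinuousAt.comp (f := fun t : ℝ => t • _) (x := (0 : ℝ)) ?_ (by fun_prop)
    rw [zero_smul]
    exact hg.continuousAt

/-- Since |φ_x(u)|² = 1 - (1-|x|²)q(u) with q = `ballQuotient x (‖x‖ ^ 2)`, this is the case k = 1
of the Laplacian formula. It provides the strictly subharmonic perturbation for the maximum
principle. -/
theorem hyperbolicLaplacian_norm_sq_pos {n : ℕ} (hn : 2 < n) {x : EuclideanSpace ℝ (Fin n)}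
    (hx : ‖x‖ < 1) : 0 < hyperbolicLaplacian (fun y => ‖y‖ ^ 2) x := by
  have h : (fun u => ‖moebiusMap x u‖ ^ 2) =ᶠ[𝓝 0]
      (fun _ => 1) + (-(1 - ‖x‖ ^ 2)) • fun u => ballQuotient x (‖x‖ ^ 2) u ^ 1 := by
    filter_upwards [eventually_moebiusDenom_ne_zero x] with u hu
    have := one_sub_norm_moebiusMap_sq x u hu
    simp only [Pi.add_apply, Pi.smul_apply, smul_eq_mul, pow_one]
    linarith
  have hq : ContDiffAt ℝ 2 (fun u => ballQuotient x (‖x‖ ^ 2) u ^ 1) 0 :=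
    (contDiffAt_ballQuotient _ _).pow _
  have hq' : ContDiffAt ℝ 2 ((-(1 - ‖x‖ ^ 2)) • fun u => ballQuotient x (‖x‖ ^ 2) u ^ 1) 0 :=
    hq.const_smul (-(1 - ‖x‖ ^ 2))
  rw [hyperbolicLaplacian, (InnerProductSpace.laplacian_congr_nhds h).eq_of_nhds,
    ContDiffAt.laplacian_add contDiffAt_const hq',
    InnerProductSpace.laplacian_smul _ hq, laplacian_ballQuotient_pow]
  have h1 : ‖x‖ ^ 2 < 1 := pow_lt_one₀ (norm_nonneg x) hx two_ne_zero
  have h2 : (3 : ℝ) ≤ n := by exact_mod_cast hn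
  have h3 : 8 * ‖x‖ ^ 2 < 2 * n * (1 + ‖x‖ ^ 2) := by nlinarith [sq_nonneg ‖x‖]
  simp only [InnerProductSpace.laplacian_const, smul_eq_mul]
  norm_num
  nlinarith

/-- The maximum principle for `H`-harmonic functions on concentric balls. -/
theorem IsHHarmonic.le_of_le_on_sphere {n : ℕ} (hn : 2 < n) {f : EuclideanSpace ℝ (Fin n) → ℝ}
    (hf : IsHHarmonic f) {R c : ℝ} (hR : R < 1) (hc : ∀ x, ‖x‖ = R → f x ≤ c)
    {x : EuclideanSpace ℝ (Fin n)} (hx : ‖x‖ ≤ R) : f x ≤ c := by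
  refine le_of_forall_pos_le_add fun δ hδ => ?_
  -- The added term makes Δ_h v strictly positive, so v has no interior maximum; it costs at most δ
  -- on the boundary.
  set v : EuclideanSpace ℝ (Fin n) → ℝ := fun y => f y + δ * ‖y‖ ^ 2 with hv
  have hvc : ContDiffOn ℝ 2 v (ball 0 1) :=
    hf.contDiffOn.add (contDiff_const.mul (contDiff_norm_sq ℝ)).contDiffOn
  have hsub : closedBall (0 : EuclideanSpace ℝ (Fin n)) R ⊆ ball 0 1 := closedBall_subset_ball hR
  obtain ⟨x₀, hx₀, hmax⟩ := (isCompact_closedBall (0 : EuclideanSpace ℝ (Fin n)) R).exists_isMaxOn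
    ⟨x, mem_closedBall_zero_iff.mpr hx⟩ (hvc.continuousOn.mono hsub)
  have hx₀' : ‖x₀‖ ≤ R := mem_closedBall_zero_iff.mp hx₀
  have hvx : v x ≤ v x₀ := hmax (mem_closedBall_zero_iff.mpr hx)
  rcases hx₀'.lt_or_eq with hlt | heq
  · exfalso
    have hb : x₀ ∈ ball (0 : EuclideanSpace ℝ (Fin n)) 1 := hsub hx₀
    have hloc : IsLocalMax v x₀ :=
      hmax.isLocalMax (closedBall_mem_nhds_of_mem (mem_ball_zero_iff.mpr hlt))
    have hloc0 : IsLocalMax (fun u => v (moebiusMap x₀ u)) 0 := by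
      have : Tendsto (moebiusMap x₀) (𝓝 0) (𝓝 x₀) := by
        simpa using (contDiffAt_moebiusMap x₀).continuousAt.tendsto
      simpa [IsLocalMax, IsMaxFilter] using this.eventually hloc
    have hlap := hloc0.laplacian_zero_nonpos (hvc.contDiffAt_comp_moebiusMap hb)
    have hw : ContDiffAt ℝ 2 (fun u => ‖moebiusMap x₀ u‖ ^ 2) 0 :=
      ContDiffOn.contDiffAt_comp_moebiusMap (f := fun y => ‖y‖ ^ 2)
        (contDiff_norm_sq ℝ).contDiffOn hb
    have hw' : ContDiffAt ℝ 2 (δ • fun u => ‖moebiusMap x₀ u‖ ^ 2) 0 := hw.const_smul δ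
    have hpos := hyperbolicLaplacian_norm_sq_pos hn (mem_ball_zero_iff.mp hb)
    have hsum : Laplacian.laplacian (fun u => v (moebiusMap x₀ u)) 0 =
        hyperbolicLaplacian f x₀ + δ * hyperbolicLaplacian (fun y => ‖y‖ ^ 2) x₀ := by
      rw [hyperbolicLaplacian, hyperbolicLaplacian, ← smul_eq_mul,
        ← InnerProductSpace.laplacian_smul _ hw,
        ← ContDiffAt.laplacian_add (hf.contDiffOn.contDiffAt_comp_moebiusMap hb)
          hw']
      rfl
    rw [hsum, hf.laplacian_eq_zero x₀ hb, zero_add] at hlap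
    exact absurd hlap (not_le.mpr (mul_pos hδ hpos))
  · have h1 : ‖x₀‖ ^ 2 ≤ 1 := pow_le_one₀ (norm_nonneg _) (heq.trans_lt hR).le
    have h2 := hc x₀ heq
    have h3 : 0 ≤ δ * ‖x‖ ^ 2 := by positivity
    simp only [hv] at hvx
    nlinarith

theorem IsHHarmonic.clm_comp {𝕜 𝕜' : Type*} [RCLike 𝕜] [RCLike 𝕜'] {n : ℕ}
    {f : EuclideanSpace ℝ (Fin n) → 𝕜} (hf : IsHHarmonic f) (L : 𝕜 →L[ℝ] 𝕜') :
    IsHHarmonic (fun x => L (f x)) where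
  contDiffOn := L.contDiff.comp_contDiffOn hf.contDiffOn
  laplacian_eq_zero x hx := by
    have := ContDiffAt.laplacian_CLM_comp_left (l := L)
      (hf.contDiffOn.contDiffAt_comp_moebiusMap hx)
    have h0 := hf.laplacian_eq_zero x hx
    rw [hyperbolicLaplacian] at h0 ⊢
    rw [← map_zero L, ← h0]
    exact this

theorem IsHHarmonic.add {n : ℕ} {f g : EuclideanSpace ℝ (Fin n) → ℝ} (hf : IsHHarmonic f)
    (hg : IsHHarmonic g) : IsHHarmonic (fun x => f x + g x) where
  contDiffOn := hf.contDiffOn.add hg.contDiffOn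
  laplacian_eq_zero x hx := by
    have := ContDiffAt.laplacian_add (hf.contDiffOn.contDiffAt_comp_moebiusMap hx)
      (hg.contDiffOn.contDiffAt_comp_moebiusMap hx)
    have h1 := hf.laplacian_eq_zero x hx
    have h2 := hg.laplacian_eq_zero x hx
    rw [hyperbolicLaplacian] at h1 h2 ⊢
    rw [h1, h2, add_zero] at this
    exact this

theorem IsHHarmonic.const_mul {n : ℕ} {f : EuclideanSpace ℝ (Fin n) → ℝ} (hf : IsHHarmonic f)
    (c : ℝ) : IsHHarmonic (fun x => c * f x) :=
  hf.clm_comp (c • ContinuousLinearMap.id ℝ ℝ)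

theorem isHHarmonic_const {n : ℕ} (c : ℝ) :
    IsHHarmonic (fun _ : EuclideanSpace ℝ (Fin n) => c) where
  contDiffOn := contDiffOn_const
  laplacian_eq_zero x hx := by simp [hyperbolicLaplacian]

theorem IsHHarmonic.abs_sub_le_of_sphere {n : ℕ} (hn : 2 < n)
    {f g : EuclideanSpace ℝ (Fin n) → ℝ} (hf : IsHHarmonic f) (hg : IsHHarmonic g) {R c : ℝ}
    (hR : R < 1) (hc : ∀ x, ‖x‖ = R → |f x - g x| ≤ c) {x : EuclideanSpace ℝ (Fin n)}
    (hx : ‖x‖ ≤ R) : |f x - g x| ≤ c := by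
  rw [abs_le]
  constructor
  · have := (hg.add (hf.const_mul (-1))).le_of_le_on_sphere hn hR (c := c)
      (fun y hy => by linarith [(abs_le.mp (hc y hy)).1]) hx
    linarith
  · have := (hf.add (hg.const_mul (-1))).le_of_le_on_sphere hn hR (c := c)
      (fun y hy => by linarith [(abs_le.mp (hc y hy)).2]) hx
    linarith

/-! ### Differentiation under integrals over a compact space -/

theorem Continuous.integrable_of_compactSpace {G S : Type*} [NormedAddCommGroup G]
    [TopologicalSpace S] [CompactSpace S] [SecondCountableTopology S] [MeasurableSpace S]
    [BorelSpace S] {g : S → G} (hg : Continuous g) (μ : Measure S) [IsFiniteMeasure μ] :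
    Integrable g μ := by
  obtain ⟨C, hC⟩ := isCompact_univ.exists_bound_of_continuousOn hg.continuousOn
  exact Integrable.of_bound hg.aestronglyMeasurable C (ae_of_all _ fun s => hC s (mem_univ s))

section ParametricIntegral

variable {E H G : Type} [NormedAddCommGroup E] [NormedAddCommGroup H] [NormedAddCommGroup G]
  [NormedSpace ℝ G] {S : Type} [TopologicalSpace S]

/-- The sphere carries no linear structure, so integrands are taken as restrictions, along a map i
from S to a normed space, of functions on an open subset of E × H. The weight h is only continuous
and is never differentiated. -/
theorem ContinuousOn.continuousAt_weighted {F : E × H → G} {W : Set (E × H)} (hW : IsOpen W)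
    (hF : ContinuousOn F W) {i : S → H} (hi : Continuous i) {h : S → ℝ} (hh : Continuous h)
    {p : E × S} (hp : (p.1, i p.2) ∈ W) :
    ContinuousAt (fun p : E × S => h p.2 • F (p.1, i p.2)) p := by
  have h2 : ContinuousAt (fun p : E × S => (p.1, i p.2)) p := by fun_prop
  exact ContinuousAt.smul (hh.comp continuous_snd).continuousAt
    (ContinuousAt.comp (g := F) (hF.continuousAt (hW.mem_nhds hp)) h2)

theorem ContinuousOn.continuous_weighted {F : E × H → G} {W : Set (E × H)} (hW : IsOpen W)
    (hF : ContinuousOn F W) {i : S → H} (hi : Continuous i) {h : S → ℝ} (hh : Continuous h)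
    {x : E} (hx : ∀ s, (x, i s) ∈ W) : Continuous fun s => h s • F (x, i s) :=
  continuous_iff_continuousAt.mpr fun s =>
    ContinuousAt.comp (f := fun s => (x, s)) (g := fun p : E × S => h p.2 • F (p.1, i p.2))
      (hF.continuousAt_weighted hW hi hh (hx s)) (by fun_prop)

/-- A tube-lemma argument: compactness of S makes the neighbourhood of x₀ independent of s. The
constant C is the dominating function in what follows. -/
theorem ContinuousOn.eventually_weighted_le [CompactSpace S] {F : E × H → G} {W : Set (E × H)}
    (hW : IsOpen W) (hF : ContinuousOn F W) {i : S → H} (hi : Continuous i) {h : S → ℝ}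
    (hh : Continuous h) {x₀ : E} (hx : ∀ s, (x₀, i s) ∈ W) :
    ∃ C : ℝ, ∀ᶠ x in 𝓝 x₀, ∀ s, (x, i s) ∈ W ∧ ‖h s • F (x, i s)‖ ≤ C := by
  obtain ⟨C, hC⟩ := isCompact_univ.exists_bound_of_continuousOn
    (hF.continuous_weighted hW hi hh hx).continuousOn
  refine ⟨C + 1, ?_⟩
  have hev : ∀ᶠ x in 𝓝 x₀, ∀ s ∈ (univ : Set S), (x, i s) ∈ W ∧ ‖h s • F (x, i s)‖ < C + 1 := by
    refine isCompact_univ.eventually_forall_of_forall_eventually fun s _ => ?_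
    have h2 : ContinuousAt (fun p : E × S => (p.1, i p.2)) (x₀, s) := by fun_prop
    exact (h2.eventually (hW.mem_nhds (hx s))).and
      ((hF.continuousAt_weighted hW hi hh (hx s)).norm.eventually_lt_const
        (by linarith [hC s (mem_univ s)]))
  filter_upwards [hev] with x hx s using ⟨(hx s (mem_univ s)).1, (hx s (mem_univ s)).2.le⟩

variable [CompactSpace S] [SecondCountableTopology S] [MeasurableSpace S] [BorelSpace S]

theorem ContinuousOn.integral_weighted {F : E × H → G} {W : Set (E × H)} (hW : IsOpen W)
    (hF : ContinuousOn F W) (μ : Measure S) [IsFiniteMeasure μ] {i : S → H} (hi : Continuous i)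
    {h : S → ℝ} (hh : Continuous h) {U : Set E} (hUW : ∀ x ∈ U, ∀ s, (x, i s) ∈ W) :
    ContinuousOn (fun x => ∫ s, h s • F (x, i s) ∂μ) U := by
  intro x hx
  refine ContinuousAt.continuousWithinAt ?_
  obtain ⟨C, hC⟩ := hF.eventually_weighted_le hW hi hh (hUW x hx)
  refine continuousAt_of_dominated (bound := fun _ => C) ?_ ?_ (integrable_const _)
    (ae_of_all _ fun s => ?_)
  · filter_upwards [hC] with y hy
    exact (hF.continuous_weighted hW hi hh fun s => (hy s).1).aestronglyMeasurable
  · filter_upwards [hC] with y hy using ae_of_all _ fun s => (hy s).2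
  · exact ContinuousAt.comp (f := fun y => (y, s))
      (g := fun p : E × S => h p.2 • F (p.1, i p.2))
      (hF.continuousAt_weighted hW hi hh (hUW x hx s)) (by fun_prop)

variable [NormedSpace ℝ E] [NormedSpace ℝ H]

/-- The partial derivative is again jointly smooth on W, so differentiation under the integral can
be iterated. -/
theorem ContDiffOn.partial_fderiv {F : E × H → G} {W : Set (E × H)} (hW : IsOpen W)
    {k m : ℕ} (hF : ContDiffOn ℝ k F W) (hk : m + 1 ≤ k) :
    ContDiffOn ℝ m (fun p : E × H => fderiv ℝ (fun x => F (x, p.2)) p.1) W := fun p hp =>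
  (ContDiffAt.fderiv (f := fun (p : E × H) x => F (x, p.2)) (n := k)
    (ContDiffAt.comp _ (hF.contDiffAt (hW.mem_nhds hp))
      (contDiffAt_snd.prodMk contDiffAt_fst.snd)) contDiffAt_fst
      (by exact_mod_cast hk)).contDiffWithinAt

/-- Differentiation under the integral over a compact space. -/
theorem ContDiffOn.hasFDerivAt_integral_weighted {F : E × H → G} {W : Set (E × H)}
    (hW : IsOpen W) (hF : ContDiffOn ℝ 1 F W) (μ : Measure S) [IsFiniteMeasure μ] {i : S → H}
    (hi : Continuous i) {h : S → ℝ} (hh : Continuous h) {x₀ : E} (hx : ∀ s, (x₀, i s) ∈ W) :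
    HasFDerivAt (fun x => ∫ s, h s • F (x, i s) ∂μ)
      (∫ s, h s • fderiv ℝ (fun x => F (x, i s)) x₀ ∂μ) x₀ := by
  have hD : ContinuousOn (fun p : E × H => fderiv ℝ (fun x => F (x, p.2)) p.1) W :=
    (ContDiffOn.partial_fderiv (k := 1) (m := 0) hW (by exact_mod_cast hF) le_rfl).continuousOn
  obtain ⟨C, hC⟩ := hD.eventually_weighted_le hW hi hh hx
  refine hasFDerivAt_integral_of_dominated_of_fderiv_le
    (F' := fun x s => h s • fderiv ℝ (fun x => F (x, i s)) x) (bound := fun _ => C) hC ?_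
    ((hF.continuousOn.continuous_weighted hW hi hh hx).integrable_of_compactSpace μ)
    (hD.continuous_weighted hW hi hh hx).aestronglyMeasurable
    (ae_of_all _ fun s x hxs => (hxs s).2) (integrable_const _) (ae_of_all _ fun s x hxs => ?_)
  · filter_upwards [hC] with x hxs
    exact (hF.continuousOn.continuous_weighted hW hi hh fun s => (hxs s).1).aestronglyMeasurable
  · have h1 : DifferentiableAt ℝ F (x, i s) :=
      (hF.contDiffAt (hW.mem_nhds (hxs s).1)).differentiableAt (by simp)
    have h2 : DifferentiableAt ℝ (fun x => F (x, i s)) x :=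
      DifferentiableAt.comp (f := fun x => (x, i s)) x h1 (by fun_prop)
    exact h2.hasFDerivAt.const_smul (h s)

theorem ContDiffOn.contDiffOn_one_integral_weighted {F : E × H → G} {W : Set (E × H)}
    (hW : IsOpen W) (hF : ContDiffOn ℝ 1 F W) (μ : Measure S) [IsFiniteMeasure μ] {i : S → H}
    (hi : Continuous i) {h : S → ℝ} (hh : Continuous h) {U : Set E} (hU : IsOpen U)
    (hUW : ∀ x ∈ U, ∀ s, (x, i s) ∈ W) :
    ContDiffOn ℝ 1 (fun x => ∫ s, h s • F (x, i s) ∂μ) U := by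
  have hd : ∀ x ∈ U, HasFDerivAt (fun x => ∫ s, h s • F (x, i s) ∂μ)
      (∫ s, h s • fderiv ℝ (fun x => F (x, i s)) x ∂μ) x := fun x hx =>
    hF.hasFDerivAt_integral_weighted hW μ hi hh (hUW x hx)
  have hD : ContinuousOn (fun p : E × H => fderiv ℝ (fun x => F (x, p.2)) p.1) W :=
    (ContDiffOn.partial_fderiv (k := 1) (m := 0) hW (by exact_mod_cast hF) le_rfl).continuousOn
  rw [show (1 : WithTop ℕ∞) = 0 + 1 by norm_num, contDiffOn_succ_iff_fderiv_of_isOpen hU]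
  refine ⟨fun x hx => (hd x hx).differentiableAt.differentiableWithinAt, by simp, ?_⟩
  exact contDiffOn_zero.mpr ((hD.integral_weighted hW μ hi hh hUW).congr
    fun x hx => (hd x hx).fderiv)

theorem ContDiffOn.contDiffOn_two_integral_weighted {F : E × H → G} {W : Set (E × H)}
    (hW : IsOpen W) (hF : ContDiffOn ℝ 2 F W) (μ : Measure S) [IsFiniteMeasure μ] {i : S → H}
    (hi : Continuous i) {h : S → ℝ} (hh : Continuous h) {U : Set E} (hU : IsOpen U)
    (hUW : ∀ x ∈ U, ∀ s, (x, i s) ∈ W) :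
    ContDiffOn ℝ 2 (fun x => ∫ s, h s • F (x, i s) ∂μ) U := by
  have hd : ∀ x ∈ U, HasFDerivAt (fun x => ∫ s, h s • F (x, i s) ∂μ)
      (∫ s, h s • fderiv ℝ (fun x => F (x, i s)) x ∂μ) x := fun x hx =>
    (hF.of_le (by norm_num)).hasFDerivAt_integral_weighted hW μ hi hh (hUW x hx)
  have hD : ContDiffOn ℝ 1 (fun p : E × H => fderiv ℝ (fun x => F (x, p.2)) p.1) W := by
    exact_mod_cast ContDiffOn.partial_fderiv (k := 2) (m := 1) hW hF le_rfl
  rw [show (2 : WithTop ℕ∞) = 1 + 1 by norm_num, contDiffOn_succ_iff_fderiv_of_isOpen hU]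
  refine ⟨fun x hx => (hd x hx).differentiableAt.differentiableWithinAt, by simp, ?_⟩
  exact (hD.contDiffOn_one_integral_weighted hW μ hi hh hU hUW).congr fun x hx => (hd x hx).fderiv

theorem ContDiffOn.fderiv_integral_weighted_apply {F : E × H → G}
    {W : Set (E × H)} (hW : IsOpen W) (hF : ContDiffOn ℝ 1 F W) (μ : Measure S)
    [IsFiniteMeasure μ] {i : S → H} (hi : Continuous i) {h : S → ℝ} (hh : Continuous h) {x : E}
    (hx : ∀ s, (x, i s) ∈ W) (e : E) :
    fderiv ℝ (fun x => ∫ s, h s • F (x, i s) ∂μ) x e =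
      ∫ s, h s • fderiv ℝ (fun x => F (x, i s)) x e ∂μ := by
  have hD : ContinuousOn (fun p : E × H => fderiv ℝ (fun x => F (x, p.2)) p.1) W :=
    (ContDiffOn.partial_fderiv (k := 1) (m := 0) hW (by exact_mod_cast hF) le_rfl).continuousOn
  rw [(hF.hasFDerivAt_integral_weighted hW μ hi hh hx).fderiv, ContinuousLinearMap.integral_apply]
  · rfl
  · exact (hD.continuous_weighted hW hi hh hx).integrable_of_compactSpace μ

theorem ContDiffOn.fderiv_fderiv_integral_weighted_apply {F : E × H → G}
    {W : Set (E × H)} (hW : IsOpen W) (hF : ContDiffOn ℝ 2 F W) (μ : Measure S)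
    [IsFiniteMeasure μ] {i : S → H} (hi : Continuous i) {h : S → ℝ} (hh : Continuous h)
    {x : E} (hx : ∀ s, (x, i s) ∈ W) (e e' : E) :
    fderiv ℝ (fderiv ℝ (fun x => ∫ s, h s • F (x, i s) ∂μ)) x e e' =
      ∫ s, h s • fderiv ℝ (fderiv ℝ (fun y => F (y, i s))) x e e' ∂μ := by
  have hF1 : ContDiffOn ℝ 1 F W := hF.of_le (by norm_num)
  have hD : ContDiffOn ℝ 1 (fun p : E × H => fderiv ℝ (fun x => F (x, p.2)) p.1) W := by
    exact_mod_cast ContDiffOn.partial_fderiv (k := 2) (m := 1) hW hF le_rfl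
  obtain ⟨C, hC⟩ := hF1.continuousOn.eventually_weighted_le hW hi hh hx
  have hfd : fderiv ℝ (fun x => ∫ s, h s • F (x, i s) ∂μ) =ᶠ[𝓝 x]
      fun x => ∫ s, h s • fderiv ℝ (fun x => F (x, i s)) x ∂μ := by
    filter_upwards [hC] with y hy
    exact (hF1.hasFDerivAt_integral_weighted hW μ hi hh fun s => (hy s).1).fderiv
  have hDD : ContinuousOn (fun p : E × H =>
      fderiv ℝ (fun x => fderiv ℝ (fun y => F (y, p.2)) x) p.1) W :=
    (ContDiffOn.partial_fderiv (k := 1) (m := 0) hW (by exact_mod_cast hD) le_rfl).continuousOn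
  have hDe : ContinuousOn (fun p : E × H =>
      fderiv ℝ (fun x => fderiv ℝ (fun y => F (y, p.2)) x) p.1 e) W :=
    hDD.clm_apply continuousOn_const
  rw [hfd.fderiv_eq]
  have h1 := hD.fderiv_integral_weighted_apply hW μ hi hh hx e
  simp only at h1
  rw [h1, ContinuousLinearMap.integral_apply]
  · rfl
  · exact (hDe.continuous_weighted hW hi hh hx).integrable_of_compactSpace μ

end ParametricIntegral

theorem ContDiffOn.laplacian_integral_weighted {n : ℕ} {H S : Type} [NormedAddCommGroup H]
    [NormedSpace ℝ H] [TopologicalSpace S] [CompactSpace S] [SecondCountableTopology S]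
    [MeasurableSpace S] [BorelSpace S] {F : EuclideanSpace ℝ (Fin n) × H → ℝ}
    {W : Set (EuclideanSpace ℝ (Fin n) × H)} (hW : IsOpen W) (hF : ContDiffOn ℝ 2 F W)
    (μ : Measure S) [IsFiniteMeasure μ] {i : S → H} (hi : Continuous i) {h : S → ℝ}
    (hh : Continuous h) {x : EuclideanSpace ℝ (Fin n)} (hx : ∀ s, (x, i s) ∈ W)
    (hzero : ∀ s, Laplacian.laplacian (fun y => F (y, i s)) x = 0) :
    Laplacian.laplacian (fun x => ∫ s, h s • F (x, i s) ∂μ) x = 0 := by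
  have hD : ContDiffOn ℝ 1 (fun p : EuclideanSpace ℝ (Fin n) × H =>
      fderiv ℝ (fun x => F (x, p.2)) p.1) W := by
    exact_mod_cast ContDiffOn.partial_fderiv (k := 2) (m := 1) hW hF le_rfl
  have hDD : ContinuousOn (fun p : EuclideanSpace ℝ (Fin n) × H =>
      fderiv ℝ (fun x => fderiv ℝ (fun y => F (y, p.2)) x) p.1) W :=
    (ContDiffOn.partial_fderiv (k := 1) (m := 0) hW (by exact_mod_cast hD) le_rfl).continuousOn
  rw [InnerProductSpace.laplacian_eq_iteratedFDeriv_orthonormalBasis _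
    (EuclideanSpace.basisFun (Fin n) ℝ)]
  simp only [iteratedFDeriv_two_apply]
  simp only [Matrix.cons_val_zero, Matrix.cons_val_one,
    hF.fderiv_fderiv_integral_weighted_apply hW μ hi hh hx]
  rw [← integral_finsetSum]
  · rw [integral_eq_zero_of_ae (ae_of_all _ fun s => ?_)]
    have := hzero s
    rw [InnerProductSpace.laplacian_eq_iteratedFDeriv_orthonormalBasis _
      (EuclideanSpace.basisFun (Fin n) ℝ)] at this
    simp only [iteratedFDeriv_two_apply, Matrix.cons_val_zero, Matrix.cons_val_one] at this
    simp only [← Finset.smul_sum, this, smul_zero, Pi.zero_apply]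
  · intro j _
    exact (((hDD.clm_apply continuousOn_const).clm_apply continuousOn_const).continuous_weighted
      hW hi hh hx).integrable_of_compactSpace μ

/-! ### Rotation invariance of the sphere measure -/

theorem isProbabilityMeasure_normalizedSphereMeasure {n : ℕ} (hn : 0 < n) :
    IsProbabilityMeasure (normalizedSphereMeasure n) := by
  have : Nonempty (Fin n) := ⟨⟨0, hn⟩⟩
  have : Nontrivial (EuclideanSpace ℝ (Fin n)) := inferInstance
  refine ⟨?_⟩
  rw [normalizedSphereMeasure, Measure.smul_apply, smul_eq_mul]
  refine ENNReal.inv_mul_cancel ?_ (measure_ne_top _ _)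
  rw [Ne, Measure.measure_univ_eq_zero]
  exact Measure.toSphere_ne_zero _

instance isFiniteMeasure_normalizedSphereMeasure (n : ℕ) :
    IsFiniteMeasure (normalizedSphereMeasure n) := by
  rcases n.eq_zero_or_pos with rfl | hn
  · have : IsEmpty (sphere (0 : EuclideanSpace ℝ (Fin 0)) 1) := by
      refine ⟨fun x => ?_⟩
      have h := mem_sphere_zero_iff_norm.mp x.2
      rw [Subsingleton.elim (x : EuclideanSpace ℝ (Fin 0)) 0, norm_zero] at h
      exact zero_ne_one h
    infer_instance
  · have := isProbabilityMeasure_normalizedSphereMeasure hn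
    infer_instance

/-- The action of a linear isometry on the unit sphere. -/
noncomputable def sphereHomeomorph {n : ℕ} (e : EuclideanSpace ℝ (Fin n) ≃ₗᵢ[ℝ] EuclideanSpace ℝ (Fin n)) :
    sphere (0 : EuclideanSpace ℝ (Fin n)) 1 ≃ₜ sphere (0 : EuclideanSpace ℝ (Fin n)) 1 :=
  e.toHomeomorph.subtype fun x => by simp

@[simp]
theorem coe_sphereHomeomorph {n : ℕ}
    (e : EuclideanSpace ℝ (Fin n) ≃ₗᵢ[ℝ] EuclideanSpace ℝ (Fin n))
    (η : sphere (0 : EuclideanSpace ℝ (Fin n)) 1) :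
    (sphereHomeomorph e η : EuclideanSpace ℝ (Fin n)) = e η := rfl

-- The measure of s is, up to a constant, the volume of the cone (0,1)·s, and a linear isometry
-- carries cones to cones and preserves volume.
open scoped Pointwise in
theorem measurePreserving_sphereHomeomorph_toSphere {n : ℕ}
    (e : EuclideanSpace ℝ (Fin n) ≃ₗᵢ[ℝ] EuclideanSpace ℝ (Fin n)) :
    MeasurePreserving (sphereHomeomorph e)
      (volume : Measure (EuclideanSpace ℝ (Fin n))).toSphere
      (volume : Measure (EuclideanSpace ℝ (Fin n))).toSphere := by
  have hm : Measurable (sphereHomeomorph e) := (sphereHomeomorph e).continuous.measurable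
  refine ⟨hm, Measure.ext fun s hs => ?_⟩
  rw [Measure.map_apply hm hs, Measure.toSphere_apply' _ hs, Measure.toSphere_apply' _ (hm hs)]
  congr 1
  rw [← e.measurePreserving.measure_preimage_emb e.toHomeomorph.measurableEmbedding
    (Ioo (0 : ℝ) 1 • (Subtype.val '' s))]
  congr 1
  ext x
  simp only [Set.mem_smul, mem_preimage, mem_image]
  constructor
  · rintro ⟨r, hr, _, ⟨η, hη, rfl⟩, rfl⟩
    exact ⟨r, hr, _, ⟨_, hη, rfl⟩, by simp⟩
  · rintro ⟨r, hr, _, ⟨η, hη, rfl⟩, h⟩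
    refine ⟨r, hr, _, ⟨(sphereHomeomorph e).symm η, by simpa using hη, rfl⟩, ?_⟩
    apply e.injective
    rw [map_smul, ← coe_sphereHomeomorph, Homeomorph.apply_symm_apply, h]

theorem integral_sphere_comp {n : ℕ} {F : Type*} [NormedAddCommGroup F] [NormedSpace ℝ F]
    (e : EuclideanSpace ℝ (Fin n) ≃ₗᵢ[ℝ] EuclideanSpace ℝ (Fin n))
    (f : EuclideanSpace ℝ (Fin n) → F) :
    ∫ η : sphere (0 : EuclideanSpace ℝ (Fin n)) 1, f (e η) ∂(normalizedSphereMeasure n) =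
      ∫ η : sphere (0 : EuclideanSpace ℝ (Fin n)) 1, f η ∂(normalizedSphereMeasure n) := by
  have h : MeasurePreserving (sphereHomeomorph e) (normalizedSphereMeasure n)
      (normalizedSphereMeasure n) :=
    (measurePreserving_sphereHomeomorph_toSphere e).smul_measure _
  exact h.integral_comp (sphereHomeomorph e).measurableEmbedding
    (fun η : sphere (0 : EuclideanSpace ℝ (Fin n)) 1 => f η)

/-- Reflect in the hyperplane orthogonal to x - y. -/
theorem exists_linearIsometryEquiv_swap {n : ℕ} {x y : EuclideanSpace ℝ (Fin n)}
    (h : ‖x‖ = ‖y‖) :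
    ∃ e : EuclideanSpace ℝ (Fin n) ≃ₗᵢ[ℝ] EuclideanSpace ℝ (Fin n), e x = y ∧ e y = x := by
  have h1 := Submodule.reflection_sub h
  have h2 := Submodule.reflection_reflection (ℝ ∙ (x - y))ᗮ x
  rw [h1] at h2
  exact ⟨_, h1, h2⟩

/-! ### The kernel as an integral of two Poisson kernels -/

/-- The integral over the sphere of the product of two Poisson kernels. -/
noncomputable def szegoKernel {n : ℕ} (x y : EuclideanSpace ℝ (Fin n)) : ℝ :=
  ∫ ζ : sphere (0 : EuclideanSpace ℝ (Fin n)) 1, hPoisson x ζ * hPoisson y ζ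
    ∂(normalizedSphereMeasure n)

theorem szegoKernel_comm {n : ℕ} (x y : EuclideanSpace ℝ (Fin n)) :
    szegoKernel x y = szegoKernel y x := by
  simp only [szegoKernel, mul_comm]

theorem norm_coe_sphere {n : ℕ} (ζ : sphere (0 : EuclideanSpace ℝ (Fin n)) 1) :
    ‖(ζ : EuclideanSpace ℝ (Fin n))‖ = 1 := mem_sphere_zero_iff_norm.mp ζ.2

theorem contDiffOn_hPoisson_prod {n : ℕ} :
    ContDiffOn ℝ 2 (fun p : EuclideanSpace ℝ (Fin n) × EuclideanSpace ℝ (Fin n) =>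
      hPoisson p.1 p.2) {p | ‖p.1 - p.2‖ ≠ 0} := by
  refine ContDiffOn.pow (ContDiffOn.div ?_ ?_ fun p hp => pow_ne_zero 2 hp) _
  · exact (contDiff_const.sub ((contDiff_norm_sq ℝ).comp contDiff_fst)).contDiffOn
  · exact ((contDiff_norm_sq ℝ).comp (contDiff_fst.sub contDiff_snd)).contDiffOn

theorem isOpen_setOf_norm_sub_ne_zero {n : ℕ} :
    IsOpen {p : EuclideanSpace ℝ (Fin n) × EuclideanSpace ℝ (Fin n) | ‖p.1 - p.2‖ ≠ 0} :=
  isOpen_ne_fun (by fun_prop) continuous_const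

theorem continuous_hPoisson_right {n : ℕ} {x : EuclideanSpace ℝ (Fin n)} (hx : ‖x‖ < 1) :
    Continuous fun ζ : sphere (0 : EuclideanSpace ℝ (Fin n)) 1 => hPoisson x ζ := by
  simpa using contDiffOn_hPoisson_prod.continuousOn.continuous_weighted
    isOpen_setOf_norm_sub_ne_zero continuous_subtype_val (h := fun _ => 1) continuous_const
    (x := x) (fun ζ => sub_ne_zero_of_norm_lt hx (norm_coe_sphere ζ))

theorem contDiffOn_ballQuotient_prod {n : ℕ} (k : ℕ) :
    ContDiffOn ℝ 2 (fun p : EuclideanSpace ℝ (Fin n) × EuclideanSpace ℝ (Fin n) =>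
      ballQuotient p.2 1 p.1 ^ k) {p | 1 - 2 * inner ℝ p.2 p.1 + 1 * ‖p.1‖ ^ 2 ≠ 0} := by
  refine ContDiffOn.pow (ContDiffOn.div ?_ ?_ fun p hp => hp) _
  · exact (contDiff_const.sub ((contDiff_norm_sq ℝ).comp contDiff_fst)).contDiffOn
  · exact ((contDiff_const.sub (contDiff_const.mul (contDiff_snd.inner ℝ contDiff_fst))).add
      (contDiff_const.mul ((contDiff_norm_sq ℝ).comp contDiff_fst))).contDiffOn

theorem continuous_moebiusBoundary {n : ℕ} {x : EuclideanSpace ℝ (Fin n)} (hx : ‖x‖ < 1) :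
    Continuous fun ζ : sphere (0 : EuclideanSpace ℝ (Fin n)) 1 =>
      moebiusBoundary x (ζ : EuclideanSpace ℝ (Fin n)) := by
  unfold moebiusBoundary
  refine Continuous.smul (Continuous.inv₀ (by fun_prop) fun ζ =>
    pow_ne_zero 2 (sub_ne_zero_of_norm_lt hx (norm_coe_sphere ζ))) ?_
  fun_prop

/-- Poisson integrals of continuous functions are `H`-harmonic. -/
theorem isHHarmonic_integral_hPoisson {n : ℕ} (hn : 0 < n)
    {h : sphere (0 : EuclideanSpace ℝ (Fin n)) 1 → ℝ} (hh : Continuous h) :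
    IsHHarmonic (fun x : EuclideanSpace ℝ (Fin n) =>
      ∫ ζ : sphere (0 : EuclideanSpace ℝ (Fin n)) 1, h ζ * hPoisson x ζ
        ∂(normalizedSphereMeasure n)) where
  contDiffOn := contDiffOn_hPoisson_prod.contDiffOn_two_integral_weighted
    isOpen_setOf_norm_sub_ne_zero (normalizedSphereMeasure n) continuous_subtype_val hh isOpen_ball
    fun _ hx ζ => sub_ne_zero_of_norm_lt (mem_ball_zero_iff.mp hx) (norm_coe_sphere ζ)
  laplacian_eq_zero x hx := by
    have hx' := mem_ball_zero_iff.mp hx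
    -- The cocycle law puts P(x,ζ) into the weight and leaves an integrand whose parameter is the
    -- moved pole `moebiusBoundary x ζ`, with zero Laplacian at the origin.
    have hev : (fun u => ∫ ζ : sphere (0 : EuclideanSpace ℝ (Fin n)) 1,
        h ζ * hPoisson (moebiusMap x u) ζ ∂(normalizedSphereMeasure n)) =ᶠ[𝓝 0]
        fun u => ∫ ζ : sphere (0 : EuclideanSpace ℝ (Fin n)) 1,
          (h ζ * hPoisson x ζ) • ballQuotient (moebiusBoundary x ζ) 1 u ^ (n - 1)
            ∂(normalizedSphereMeasure n) := by
      filter_upwards [eventually_moebiusDenom_ne_zero x] with u hu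
      refine integral_congr_ae (ae_of_all _ fun ζ => ?_)
      simp only [hPoisson_moebiusMap hx' (norm_coe_sphere ζ) hu, smul_eq_mul, mul_assoc]
    rw [hyperbolicLaplacian, (InnerProductSpace.laplacian_congr_nhds hev).eq_of_nhds]
    exact (contDiffOn_ballQuotient_prod (n := n) (n - 1)).laplacian_integral_weighted
      (isOpen_ne_fun (by fun_prop) continuous_const) (normalizedSphereMeasure n)
      (continuous_moebiusBoundary hx') (hh.mul (continuous_hPoisson_right hx')) (by simp)
      fun ζ => laplacian_ballQuotient_pow_eq_zero hn (norm_moebiusBoundary hx' (norm_coe_sphere ζ))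

theorem isHHarmonic_szegoKernel {n : ℕ} (hn : 0 < n) {x : EuclideanSpace ℝ (Fin n)}
    (hx : ‖x‖ < 1) : IsHHarmonic (szegoKernel x) :=
  isHHarmonic_integral_hPoisson hn (continuous_hPoisson_right hx)

theorem hPoisson_zero_left {n : ℕ} (ζ : sphere (0 : EuclideanSpace ℝ (Fin n)) 1) :
    hPoisson 0 (ζ : EuclideanSpace ℝ (Fin n)) = 1 := by
  simp [hPoisson]

theorem szegoKernel_map {n : ℕ} (e : EuclideanSpace ℝ (Fin n) ≃ₗᵢ[ℝ] EuclideanSpace ℝ (Fin n))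
    (x y : EuclideanSpace ℝ (Fin n)) : szegoKernel (e x) (e y) = szegoKernel x y := by
  rw [szegoKernel, ← integral_sphere_comp e (fun ζ => hPoisson (e x) ζ * hPoisson (e y) ζ)]
  simp only [hPoisson_map, szegoKernel]

/-- The total mass is H-harmonic and radial in x, hence constant on spheres; the maximum principle
compares it with its value 1 at the centre. -/
theorem integral_hPoisson {n : ℕ} (hn : 2 < n) {x : EuclideanSpace ℝ (Fin n)} (hx : ‖x‖ < 1) :
    ∫ ζ : sphere (0 : EuclideanSpace ℝ (Fin n)) 1, hPoisson x ζ
      ∂(normalizedSphereMeasure n) = 1 := by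
  have := isProbabilityMeasure_normalizedSphereMeasure (n := n) (by omega)
  have h0 : ∀ y : EuclideanSpace ℝ (Fin n), szegoKernel 0 y =
      ∫ ζ : sphere (0 : EuclideanSpace ℝ (Fin n)) 1, hPoisson y ζ
        ∂(normalizedSphereMeasure n) := fun y => by
    simp only [szegoKernel, hPoisson_zero_left, one_mul]
  have hharm := isHHarmonic_szegoKernel (n := n) (by omega) (x := 0) (by simp)
  have hsph : ∀ y, ‖y‖ = ‖x‖ → |szegoKernel 0 y - szegoKernel 0 x| ≤ 0 := fun y hy => by
    obtain ⟨e, he, -⟩ := exists_linearIsometryEquiv_swap hy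
    rw [← he, ← szegoKernel_map e 0 y, map_zero, sub_self, abs_zero]
  have hcen := hharm.abs_sub_le_of_sphere hn (isHHarmonic_const (szegoKernel 0 x)) hx hsph
    (x := 0) (by simp)
  have h1 : szegoKernel (0 : EuclideanSpace ℝ (Fin n)) 0 = 1 := by
    simp only [szegoKernel, hPoisson_zero_left]
    simp
  rw [← h0, ← h1]
  linarith [abs_nonpos_iff.mp hcen]

/-! ### Binomial expansion and density of Poisson kernels on a sphere -/

/-- The vector `2x / (1 + |x|²)`. -/
noncomputable def doubleAngle {n : ℕ} (x : EuclideanSpace ℝ (Fin n)) :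
    EuclideanSpace ℝ (Fin n) := (2 / (1 + ‖x‖ ^ 2)) • x

theorem norm_doubleAngle {n : ℕ} (x : EuclideanSpace ℝ (Fin n)) :
    ‖doubleAngle x‖ = 2 * ‖x‖ / (1 + ‖x‖ ^ 2) := by
  rw [doubleAngle, norm_smul, Real.norm_of_nonneg (by positivity)]
  ring

theorem norm_doubleAngle_lt_one {n : ℕ} {x : EuclideanSpace ℝ (Fin n)} (hx : ‖x‖ < 1) :
    ‖doubleAngle x‖ < 1 := by
  rw [norm_doubleAngle, div_lt_one (by positivity)]
  nlinarith [sq_nonneg (1 - ‖x‖)]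

/-- For |ζ| = 1 one has |x-ζ|² = (1+|x|²)(1-⟨u,ζ⟩), where u = `doubleAngle x` satisfies |u| < 1;
expand (1-⟨u,ζ⟩)^(-(n-1)). -/
theorem hasSum_hPoisson {n : ℕ} (hn : 2 ≤ n) {x ζ : EuclideanSpace ℝ (Fin n)} (hx : ‖x‖ < 1)
    (hζ : ‖ζ‖ = 1) :
    HasSum (fun j : ℕ => ((1 - ‖x‖ ^ 2) / (1 + ‖x‖ ^ 2)) ^ (n - 1) *
      (((j + (n - 2)).choose (n - 2) : ℝ) * inner ℝ (doubleAngle x) ζ ^ j)) (hPoisson x ζ) := by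
  have hlt : ‖inner ℝ (doubleAngle x) ζ‖ < 1 := by
    refine (norm_inner_le_norm _ _).trans_lt ?_
    rw [hζ, mul_one]
    exact norm_doubleAngle_lt_one hx
  have h := (hasSum_choose_mul_geometric_of_norm_lt_one (n - 2) hlt).mul_left
    (((1 - ‖x‖ ^ 2) / (1 + ‖x‖ ^ 2)) ^ (n - 1))
  suffices heq : hPoisson x ζ = ((1 - ‖x‖ ^ 2) / (1 + ‖x‖ ^ 2)) ^ (n - 1) *
      (1 / (1 - inner ℝ (doubleAngle x) ζ) ^ (n - 2 + 1)) by
    rw [heq]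
    exact h
  have hne : ‖x - ζ‖ ^ 2 ≠ 0 := pow_ne_zero 2 (sub_ne_zero_of_norm_lt hx hζ)
  have h2 : ‖x - ζ‖ ^ 2 = (1 + ‖x‖ ^ 2) * (1 - inner ℝ (doubleAngle x) ζ) := by
    rw [norm_sub_sq_real, hζ, doubleAngle, inner_smul_left]
    simp only [conj_trivial]
    field_simp
    ring
  rw [hPoisson, show n - 2 + 1 = n - 1 by omega, h2, one_div, ← inv_pow, ← mul_pow,
    ← div_eq_mul_inv, div_div]

/-- The coordinate functions on the unit sphere. -/
noncomputable def sphereCoord {n : ℕ} (k : Fin n) :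
    C(sphere (0 : EuclideanSpace ℝ (Fin n)) 1, ℝ) :=
  ⟨fun η => (η : EuclideanSpace ℝ (Fin n)) k, by fun_prop⟩

/-- Monomials, as functions on the unit sphere. -/
noncomputable def sphereMonomial {n j : ℕ} (I : Fin j → Fin n) :
    C(sphere (0 : EuclideanSpace ℝ (Fin n)) 1, ℝ) := ∏ i, sphereCoord (I i)

theorem sphereMonomial_apply {n j : ℕ} (I : Fin j → Fin n)
    (η : sphere (0 : EuclideanSpace ℝ (Fin n)) 1) :
    sphereMonomial I η = ∏ i, (η : EuclideanSpace ℝ (Fin n)) (I i) := by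
  simp [sphereMonomial, sphereCoord]

/-- A continuous functional that kills all monomials vanishes. -/
theorem eq_zero_of_sphereMonomial {n : ℕ}
    (L : C(sphere (0 : EuclideanSpace ℝ (Fin n)) 1, ℝ) →L[ℝ] ℝ)
    (hL : ∀ (j : ℕ) (I : Fin j → Fin n), L (sphereMonomial I) = 0) : L = 0 := by
  set A : Subalgebra ℝ C(sphere (0 : EuclideanSpace ℝ (Fin n)) 1, ℝ) :=
    Algebra.adjoin ℝ (range sphereCoord) with hA
  have hsep : A.SeparatesPoints := fun x y hxy => by
    have : ∃ k, (x : EuclideanSpace ℝ (Fin n)) k ≠ (y : EuclideanSpace ℝ (Fin n)) k := by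
      by_contra! h
      exact hxy (Subtype.ext (by ext k; exact h k))
    obtain ⟨k, hk⟩ := this
    exact ⟨_, ⟨sphereCoord k, Algebra.subset_adjoin ⟨k, rfl⟩, rfl⟩, hk⟩
  have hdense := ContinuousMap.subalgebra_topologicalClosure_eq_top_of_separatesPoints A hsep
  have hmon : ∀ g ∈ Submonoid.closure (range (sphereCoord (n := n))),
      ∃ (j : ℕ) (I : Fin j → Fin n), g = sphereMonomial I := by
    intro g hg
    induction hg using Submonoid.closure_induction_left with
    | one => exact ⟨0, Fin.elim0, by simp [sphereMonomial]⟩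
    | mul_left x hx y hy ih =>
      obtain ⟨k, rfl⟩ := hx
      obtain ⟨j, I, rfl⟩ := ih
      exact ⟨j + 1, Fin.cons k I, by simp [sphereMonomial, Fin.prod_univ_succ]⟩
  have hker : (A : Set C(sphere (0 : EuclideanSpace ℝ (Fin n)) 1, ℝ)) ⊆ L ⁻¹' {0} := by
    have : Subalgebra.toSubmodule A ≤ LinearMap.ker (L : _ →ₗ[ℝ] ℝ) := by
      rw [hA, Algebra.adjoin_eq_span, Submodule.span_le]
      intro g hg
      obtain ⟨j, I, rfl⟩ := hmon g hg
      exact hL j I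
    exact this
  have hclosed : IsClosed (L ⁻¹' {0}) := isClosed_singleton.preimage L.continuous
  ext g
  have hg : g ∈ A.topologicalClosure := by rw [hdense]; trivial
  exact closure_minimal hker hclosed hg

theorem inner_pow_eq_sum_sphereMonomial {n : ℕ} (j : ℕ)
    (ζ η : sphere (0 : EuclideanSpace ℝ (Fin n)) 1) :
    (inner ℝ (ζ : EuclideanSpace ℝ (Fin n)) (η : EuclideanSpace ℝ (Fin n)) : ℝ) ^ j =
      ∑ I : Fin j → Fin n, sphereMonomial I ζ * sphereMonomial I η := by
  rw [PiLp.inner_apply, Fintype.sum_pow]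
  refine Finset.sum_congr rfl fun I _ => ?_
  rw [sphereMonomial_apply, sphereMonomial_apply, ← Finset.prod_mul_distrib]
  simp [mul_comm]

/-- The function `η ↦ ⟨ζ, η⟩ ^ j` on the sphere. -/
noncomputable def sphereInnerPow {n : ℕ} (j : ℕ) (ζ : sphere (0 : EuclideanSpace ℝ (Fin n)) 1) :
    C(sphere (0 : EuclideanSpace ℝ (Fin n)) 1, ℝ) :=
  ∑ I : Fin j → Fin n, sphereMonomial I ζ • sphereMonomial I

theorem sphereInnerPow_apply {n : ℕ} (j : ℕ) (ζ η : sphere (0 : EuclideanSpace ℝ (Fin n)) 1) :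
    sphereInnerPow j ζ η =
      (inner ℝ (ζ : EuclideanSpace ℝ (Fin n)) (η : EuclideanSpace ℝ (Fin n)) : ℝ) ^ j := by
  rw [inner_pow_eq_sum_sphereMonomial, sphereInnerPow]
  simp [ContinuousMap.sum_apply]

theorem norm_sphereInnerPow_le {n : ℕ} (j : ℕ) (ζ : sphere (0 : EuclideanSpace ℝ (Fin n)) 1) :
    ‖sphereInnerPow j ζ‖ ≤ 1 := by
  refine (ContinuousMap.norm_le _ zero_le_one).mpr fun η => ?_
  rw [sphereInnerPow_apply, norm_pow]
  refine pow_le_one₀ (norm_nonneg _) ((norm_inner_le_norm _ _).trans ?_)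
  rw [norm_coe_sphere, norm_coe_sphere, one_mul]

/-- A functional annihilating all the zonal functions `Σ_j b_j ⟨ζ, ·⟩ ^ j`, where all the
`b_j` are positive, is zero. -/
theorem eq_zero_of_zonal {n : ℕ} {b : ℕ → ℝ} (hb : ∀ j, 0 < b j) (hs : Summable b)
    (L : C(sphere (0 : EuclideanSpace ℝ (Fin n)) 1, ℝ) →L[ℝ] ℝ)
    (hL : ∀ ζ, L (∑' j, b j • sphereInnerPow j ζ) = 0) : L = 0 := by
  have hsum : ∀ ζ : sphere (0 : EuclideanSpace ℝ (Fin n)) 1,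
      Summable fun j => b j • sphereInnerPow j ζ := fun ζ => by
    refine Summable.of_norm_bounded hs fun j => ?_
    rw [norm_smul, Real.norm_of_nonneg (hb j).le]
    exact mul_le_of_le_one_right (hb j).le (norm_sphereInnerPow_le j ζ)
  set q : ℕ → C(sphere (0 : EuclideanSpace ℝ (Fin n)) 1, ℝ) := fun j =>
    ∑ I : Fin j → Fin n, L (sphereMonomial I) • sphereMonomial I with hq
  have hqL : ∀ j ζ, q j ζ = L (sphereInnerPow j ζ) := fun j ζ => by
    simp [hq, sphereInnerPow, ContinuousMap.sum_apply, mul_comm]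
  have hqsum : Summable fun j => b j • q j := by
    refine Summable.of_norm_bounded (hs.mul_right ‖L‖) fun j => ?_
    rw [norm_smul, Real.norm_of_nonneg (hb j).le]
    refine mul_le_mul_of_nonneg_left ?_ (hb j).le
    rw [ContinuousMap.norm_le _ (norm_nonneg L)]
    intro ζ
    rw [hqL]
    exact (L.le_opNorm _).trans
      (mul_le_of_le_one_right (norm_nonneg _) (norm_sphereInnerPow_le j ζ))
  have hq0 : ∑' j, b j • q j = 0 := by
    ext ζ
    rw [← (ContinuousMap.hasSum_apply hqsum.hasSum ζ).tsum_eq, ContinuousMap.zero_apply, ← hL ζ,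
      L.map_tsum (hsum ζ)]
    exact tsum_congr fun j => by simp [hqL]
  -- Applying L a second time, now in the variable ζ, produces Σ_j b_j Σ_I L(m_I)² = 0 over the
  -- monomials m_I; positivity of the b_j kills every term.
  have h0 : HasSum (fun j => L (b j • q j)) 0 := by
    have := L.hasSum hqsum.hasSum
    rwa [hq0, map_zero] at this
  have hval : ∀ j, L (b j • q j) = b j * ∑ I : Fin j → Fin n, L (sphereMonomial I) ^ 2 :=
    fun j => by simp [hq, sq]
  rw [hasSum_zero_iff_of_nonneg fun j => by
    rw [hval]; exact mul_nonneg (hb j).le (Finset.sum_nonneg fun I _ => sq_nonneg _)] at h0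
  refine eq_zero_of_sphereMonomial L fun j I => ?_
  have hj := congrFun h0 j
  rw [hval, Pi.zero_apply, mul_eq_zero, or_iff_right (hb j).ne',
    Finset.sum_eq_zero_iff_of_nonneg fun I _ => sq_nonneg _] at hj
  exact pow_eq_zero_iff two_ne_zero |>.mp (hj I (Finset.mem_univ I))

theorem Submodule.mem_closure_of_forall_dual {V : Type*} [NormedAddCommGroup V] [NormedSpace ℝ V]
    (W : Submodule ℝ V) (hW : ∀ L : V →L[ℝ] ℝ, (∀ w ∈ W, L w = 0) → L = 0) (v : V) :
    v ∈ closure (W : Set V) := by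
  by_contra hv
  obtain ⟨L, u, h1, h2⟩ := geometric_hahn_banach_closed_point (W.convex.closure) isClosed_closure hv
  have h0 : 0 < u := by simpa using h1 0 (subset_closure W.zero_mem)
  have hL : L = 0 := hW L fun w hw => by
    by_contra hne
    -- A functional bounded above on a subspace vanishes there: this multiple of w would attain the
    -- strict bound u.
    have := h1 ((u / L w) • w) (subset_closure (W.smul_mem _ hw))
    rw [map_smul, smul_eq_mul, div_mul_cancel₀ _ hne] at this
    exact lt_irrefl _ this
  rw [hL, zero_apply] at h2
  exact lt_asymm h0 h2

/-- The restriction of `P(·, ζ)` to the sphere of radius `R`. -/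
noncomputable def hPoissonSphere {n : ℕ} (R : ℝ) (hR : |R| < 1)
    (ζ : sphere (0 : EuclideanSpace ℝ (Fin n)) 1) :
    C(sphere (0 : EuclideanSpace ℝ (Fin n)) 1, ℝ) :=
  ⟨fun η => hPoisson (R • (η : EuclideanSpace ℝ (Fin n))) ζ, by
    refine (contDiffOn_hPoisson (norm_coe_sphere ζ)).continuousOn.comp_continuous (by fun_prop)
      fun η => ?_
    rw [mem_ball_zero_iff, norm_smul, norm_coe_sphere, mul_one]
    exact hR⟩

/-- Functions `P(R·, ζ)` span a dense subspace of `C(S)`. -/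
theorem mem_closure_span_hPoissonSphere {n : ℕ} (hn : 2 ≤ n) {R : ℝ} (hR0 : 0 < R) (hR : |R| < 1)
    (g : C(sphere (0 : EuclideanSpace ℝ (Fin n)) 1, ℝ)) :
    g ∈ closure (Submodule.span ℝ (range (hPoissonSphere (n := n) R hR)) :
      Set C(sphere (0 : EuclideanSpace ℝ (Fin n)) 1, ℝ)) := by
  refine Submodule.mem_closure_of_forall_dual _ (fun L hL => ?_) g
  have hR1 : R < 1 := (abs_lt.mp hR).2
  have hR2 : R ^ 2 < 1 := pow_lt_one₀ hR0.le hR1 two_ne_zero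
  set c : ℝ := 2 / (1 + R ^ 2) * R with hc
  have hc0 : 0 < c := by positivity
  have hc1 : c < 1 := by
    rw [hc, div_mul_eq_mul_div, div_lt_one (by positivity)]
    nlinarith [sq_nonneg (1 - R)]
  -- The coefficients of P(Rη,ζ) in powers of ⟨ζ,η⟩, with c = |`doubleAngle (R • η)`|; they are all
  -- positive because 0 < R < 1.
  set b : ℕ → ℝ := fun j => ((1 - R ^ 2) / (1 + R ^ 2)) ^ (n - 1) *
    (((j + (n - 2)).choose (n - 2) : ℝ) * c ^ j) with hb
  have hbpos : ∀ j, 0 < b j := fun j => by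
    have h1 : 0 < (1 - R ^ 2) / (1 + R ^ 2) := div_pos (by linarith) (by positivity)
    have h2 : 0 < (j + (n - 2)).choose (n - 2) := Nat.choose_pos (Nat.le_add_left _ _)
    exact mul_pos (pow_pos h1 _) (mul_pos (by exact_mod_cast h2) (pow_pos hc0 j))
  have hbs : Summable b := (hasSum_choose_mul_geometric_of_norm_lt_one (n - 2) (r := c)
    (by rwa [Real.norm_of_nonneg hc0.le])).summable.mul_left _
  have hsum : ∀ ζ : sphere (0 : EuclideanSpace ℝ (Fin n)) 1,
      Summable fun j => b j • sphereInnerPow j ζ := fun ζ => by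
    refine Summable.of_norm_bounded hbs fun j => ?_
    rw [norm_smul, Real.norm_of_nonneg (hbpos j).le]
    exact mul_le_of_le_one_right (hbpos j).le (norm_sphereInnerPow_le j ζ)
  refine eq_zero_of_zonal hbpos hbs L fun ζ => ?_
  rw [← hL _ (Submodule.subset_span ⟨ζ, rfl⟩)]
  congr 1
  ext η
  rw [← (ContinuousMap.hasSum_apply (hsum ζ).hasSum η).tsum_eq]
  have hnorm : ‖R • (η : EuclideanSpace ℝ (Fin n))‖ = R := by
    rw [norm_smul, norm_coe_sphere, mul_one, Real.norm_of_nonneg hR0.le]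
  have h := hasSum_hPoisson hn (x := R • (η : EuclideanSpace ℝ (Fin n))) (by rwa [hnorm])
    (norm_coe_sphere ζ)
  rw [hnorm] at h
  refine Eq.trans (tsum_congr fun j => ?_) h.tsum_eq
  rw [ContinuousMap.smul_apply, sphereInnerPow_apply, doubleAngle, hnorm, inner_smul_left,
    inner_smul_left, smul_eq_mul, real_inner_comm]
  simp only [conj_trivial, hb, hc]
  ring

/-! ### Boundary behaviour of Poisson integrals -/

theorem norm_smul_sphere {n : ℕ} (r : ℝ) (η : sphere (0 : EuclideanSpace ℝ (Fin n)) 1) :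
    ‖r • (η : EuclideanSpace ℝ (Fin n))‖ = |r| := by
  rw [norm_smul, norm_coe_sphere, mul_one, Real.norm_eq_abs]

theorem ContDiffOn.continuous_smul_sphere {n : ℕ} {F : Type*} [NormedAddCommGroup F]
    [NormedSpace ℝ F] {f : EuclideanSpace ℝ (Fin n) → F} (hf : ContDiffOn ℝ 2 f (ball 0 1)) {r : ℝ}
    (hr : |r| < 1) :
    Continuous fun η : sphere (0 : EuclideanSpace ℝ (Fin n)) 1 =>
      f (r • (η : EuclideanSpace ℝ (Fin n))) :=
  hf.continuousOn.comp_continuous (by fun_prop) fun η => by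
    rwa [mem_ball_zero_iff, norm_smul_sphere]

theorem abs_integral_mul_hPoisson_le {n : ℕ} (hn : 2 < n)
    {u : sphere (0 : EuclideanSpace ℝ (Fin n)) 1 → ℝ} {ε : ℝ} (hu : ∀ η, |u η| ≤ ε)
    {x : EuclideanSpace ℝ (Fin n)} (hx : ‖x‖ < 1) :
    |∫ η : sphere (0 : EuclideanSpace ℝ (Fin n)) 1, u η * hPoisson x η
      ∂(normalizedSphereMeasure n)| ≤ ε := by
  have h := norm_integral_le_of_norm_le (μ := normalizedSphereMeasure n)
    (f := fun η : sphere (0 : EuclideanSpace ℝ (Fin n)) 1 => u η * hPoisson x η)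
    (g := fun η => ε * hPoisson x η)
    (((continuous_hPoisson_right hx).integrable_of_compactSpace _).const_mul ε)
    (ae_of_all _ fun η => by
      rw [norm_mul, Real.norm_eq_abs, Real.norm_of_nonneg (hPoisson_nonneg hx.le _)]
      exact mul_le_mul_of_nonneg_right (hu η) (hPoisson_nonneg hx.le _))
  rwa [integral_const_mul, integral_hPoisson hn hx, mul_one, Real.norm_eq_abs] at h

theorem integral_sub_mul_hPoisson {n : ℕ} {u v : sphere (0 : EuclideanSpace ℝ (Fin n)) 1 → ℝ}
    (hu : Continuous u) (hv : Continuous v) {x : EuclideanSpace ℝ (Fin n)} (hx : ‖x‖ < 1) :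
    ∫ η : sphere (0 : EuclideanSpace ℝ (Fin n)) 1, (u η - v η) * hPoisson x η
        ∂(normalizedSphereMeasure n) =
      ∫ η : sphere (0 : EuclideanSpace ℝ (Fin n)) 1, u η * hPoisson x η
        ∂(normalizedSphereMeasure n) -
      ∫ η : sphere (0 : EuclideanSpace ℝ (Fin n)) 1, v η * hPoisson x η
        ∂(normalizedSphereMeasure n) := by
  have hP := continuous_hPoisson_right hx
  simp only [sub_mul]
  exact integral_sub ((hu.mul hP).integrable_of_compactSpace _)
    ((hv.mul hP).integrable_of_compactSpace _)

theorem hPoisson_le_of_le_norm_sub {n : ℕ} {x ζ : EuclideanSpace ℝ (Fin n)} {δ : ℝ} (hδ : 0 < δ)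
    (hx : ‖x‖ ≤ 1) (h : δ ≤ ‖x - ζ‖) :
    hPoisson x ζ ≤ ((1 - ‖x‖ ^ 2) / δ ^ 2) ^ (n - 1) := by
  have h1 : ‖x‖ ^ 2 ≤ 1 := pow_le_one₀ (norm_nonneg x) hx
  have h2 : 0 ≤ 1 - ‖x‖ ^ 2 := by linarith
  unfold hPoisson
  gcongr

/-- Poisson integrals of a continuous function converge uniformly to it at the boundary. -/
theorem eventually_abs_integral_hPoisson_sub_le {n : ℕ} (hn : 2 < n)
    {g : sphere (0 : EuclideanSpace ℝ (Fin n)) 1 → ℝ} (hg : Continuous g) {ε : ℝ} (hε : 0 < ε) :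
    ∀ᶠ r : ℝ in 𝓝[<] 1, ∀ ζ : sphere (0 : EuclideanSpace ℝ (Fin n)) 1,
      |∫ η : sphere (0 : EuclideanSpace ℝ (Fin n)) 1,
        g η * hPoisson (r • (ζ : EuclideanSpace ℝ (Fin n))) η ∂(normalizedSphereMeasure n) - g ζ| ≤
        ε := by
  have := isProbabilityMeasure_normalizedSphereMeasure (n := n) (by omega)
  obtain ⟨δ, hδ, huc⟩ := Metric.uniformContinuous_iff.mp
    (CompactSpace.uniformContinuous_of_continuous hg) (ε / 2) (by positivity)
  obtain ⟨M, hM⟩ := isCompact_univ.exists_bound_of_continuousOn hg.continuousOn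
  -- This bounds the contribution of points η far from ζ: the oscillation of g is at most 2|M|, and
  -- |rζ-η| ≥ δ/2 once r > 1 - δ/2.
  have hlim : Tendsto (fun r : ℝ => 2 * |M| * ((1 - r ^ 2) / (δ / 2) ^ 2) ^ (n - 1)) (𝓝[<] 1)
      (𝓝 0) := by
    have hc : Continuous fun r : ℝ => 2 * |M| * ((1 - r ^ 2) / (δ / 2) ^ 2) ^ (n - 1) := by
      fun_prop
    have := (hc.tendsto 1).mono_left (nhdsWithin_le_nhds (s := Iio 1))
    simpa [show n - 1 ≠ 0 by omega] using this
  have hev1 : ∀ᶠ r : ℝ in 𝓝[<] 1, r < 1 := eventually_mem_nhdsWithin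
  have hev2 : ∀ᶠ r : ℝ in 𝓝[<] 1, max 0 (1 - δ / 2) < r :=
    nhdsWithin_le_nhds (lt_mem_nhds (max_lt one_pos (by linarith)))
  filter_upwards [hlim.eventually_le_const (u := ε / 2) (by positivity), hev1, hev2]
    with r hrM hr1 hr2 ζ
  have hr0 : 0 < r := (le_max_left _ _).trans_lt hr2
  have hrδ : 1 - δ / 2 < r := (le_max_right _ _).trans_lt hr2
  have hnorm : ‖r • (ζ : EuclideanSpace ℝ (Fin n))‖ = r := by
    rw [norm_smul_sphere, abs_of_pos hr0]
  have hlt : ‖r • (ζ : EuclideanSpace ℝ (Fin n))‖ < 1 := by rwa [hnorm]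
  have hP := continuous_hPoisson_right hlt
  have hpt : ∀ η : sphere (0 : EuclideanSpace ℝ (Fin n)) 1,
      ‖(g η - g ζ) * hPoisson (r • (ζ : EuclideanSpace ℝ (Fin n))) η‖ ≤
        ε / 2 * hPoisson (r • (ζ : EuclideanSpace ℝ (Fin n))) η + ε / 2 := fun η => by
    have hnn := hPoisson_nonneg hlt.le (η : EuclideanSpace ℝ (Fin n))
    rw [norm_mul, Real.norm_of_nonneg hnn]
    by_cases hd : dist η ζ < δ
    · have := (huc hd).le
      rw [Real.dist_eq] at this
      rw [Real.norm_eq_abs]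
      linarith [mul_le_mul_of_nonneg_right this hnn]
    · have hd' : δ / 2 ≤ ‖r • (ζ : EuclideanSpace ℝ (Fin n)) - η‖ := by
        have h1 : δ ≤ ‖(ζ : EuclideanSpace ℝ (Fin n)) - η‖ := by
          rw [not_lt, dist_comm, Subtype.dist_eq, dist_eq_norm] at hd
          exact hd
        have h2 : ‖(ζ : EuclideanSpace ℝ (Fin n)) - r • (ζ : EuclideanSpace ℝ (Fin n))‖ = 1 - r := by
          rw [show (ζ : EuclideanSpace ℝ (Fin n)) - r • (ζ : EuclideanSpace ℝ (Fin n)) =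
            (1 - r) • (ζ : EuclideanSpace ℝ (Fin n)) by rw [sub_smul, one_smul], norm_smul_sphere,
            abs_of_pos (by linarith)]
        have h3 := norm_sub_le_norm_sub_add_norm_sub (ζ : EuclideanSpace ℝ (Fin n))
          (r • (ζ : EuclideanSpace ℝ (Fin n))) η
        linarith
      have hle := hPoisson_le_of_le_norm_sub (by positivity) hlt.le hd'
      rw [hnorm] at hle
      have hosc : ‖g η - g ζ‖ ≤ 2 * |M| := by
        have h1 := (hM η (mem_univ _)).trans (le_abs_self M)
        have h2 := (hM ζ (mem_univ _)).trans (le_abs_self M)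
        linarith [norm_sub_le (g η) (g ζ)]
      have := mul_le_mul hosc hle hnn (by positivity)
      have h4 : 0 ≤ ε / 2 * hPoisson (r • (ζ : EuclideanSpace ℝ (Fin n))) η := by positivity
      linarith
  have hsub : ∫ η : sphere (0 : EuclideanSpace ℝ (Fin n)) 1,
        g η * hPoisson (r • (ζ : EuclideanSpace ℝ (Fin n))) η ∂(normalizedSphereMeasure n) - g ζ =
      ∫ η : sphere (0 : EuclideanSpace ℝ (Fin n)) 1,
        (g η - g ζ) * hPoisson (r • (ζ : EuclideanSpace ℝ (Fin n))) η
          ∂(normalizedSphereMeasure n) := by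
    rw [integral_sub_mul_hPoisson hg continuous_const hlt, integral_const_mul,
      integral_hPoisson hn hlt, mul_one]
  rw [hsub, ← Real.norm_eq_abs]
  have hint := hP.integrable_of_compactSpace (normalizedSphereMeasure n)
  refine (norm_integral_le_of_norm_le ((hint.const_mul (ε / 2)).add (integrable_const (ε / 2)))
    (ae_of_all _ hpt)).trans_eq ?_
  simp only [Pi.add_apply]
  rw [integral_add (hint.const_mul (ε / 2)) (integrable_const _), integral_const_mul,
    integral_hPoisson hn hlt]
  simp

/-! ### Reproducing property and uniqueness -/

/-- The reflection exchanging ω and ζ leaves K invariant; then use the symmetry of K. -/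
theorem szegoKernel_smul_swap {n : ℕ} (r s : ℝ) (ω ζ : sphere (0 : EuclideanSpace ℝ (Fin n)) 1) :
    szegoKernel (r • (ω : EuclideanSpace ℝ (Fin n))) (s • (ζ : EuclideanSpace ℝ (Fin n))) =
      szegoKernel (s • (ω : EuclideanSpace ℝ (Fin n))) (r • (ζ : EuclideanSpace ℝ (Fin n))) := by
  obtain ⟨e, h1, h2⟩ := exists_linearIsometryEquiv_swap
    ((norm_coe_sphere ω).trans (norm_coe_sphere ζ).symm)
  rw [← szegoKernel_map e, map_smul, map_smul, h1, h2, szegoKernel_comm]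

/-- Dilating by `r` and taking the Poisson integral on the sphere of radius `s` is symmetric in
`r` and `s`. -/
theorem IsHHarmonic.integral_smul_mul_hPoisson_comm {n : ℕ} (hn : 2 < n)
    {f : EuclideanSpace ℝ (Fin n) → ℝ} (hf : IsHHarmonic f) {r s : ℝ} (hr0 : 0 < r) (hr : r < 1)
    (hs0 : 0 ≤ s) (hs : s < 1) (ζ : sphere (0 : EuclideanSpace ℝ (Fin n)) 1) :
    ∫ η : sphere (0 : EuclideanSpace ℝ (Fin n)) 1, f (r • (η : EuclideanSpace ℝ (Fin n))) *
        hPoisson (s • (ζ : EuclideanSpace ℝ (Fin n))) η ∂(normalizedSphereMeasure n) =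
      ∫ η : sphere (0 : EuclideanSpace ℝ (Fin n)) 1, f (s • (η : EuclideanSpace ℝ (Fin n))) *
        hPoisson (r • (ζ : EuclideanSpace ℝ (Fin n))) η ∂(normalizedSphereMeasure n) := by
  -- Approximating f on the sphere of radius R controls it, by the maximum principle, on both radii
  -- r and s.
  set R := max r s with hR
  have hR0 : 0 < R := hr0.trans_le (le_max_left _ _)
  have hR1 : R < 1 := max_lt hr hs
  have hRa : |R| < 1 := by rwa [abs_of_pos hR0]
  have hra : |r| < 1 := by rwa [abs_of_pos hr0]
  have hsa : |s| < 1 := by rwa [abs_of_nonneg hs0]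
  have hrn : ‖r • (ζ : EuclideanSpace ℝ (Fin n))‖ < 1 := by rwa [norm_smul_sphere]
  have hsn : ‖s • (ζ : EuclideanSpace ℝ (Fin n))‖ < 1 := by rwa [norm_smul_sphere]
  have hPr := continuous_hPoisson_right hrn
  have hPs := continuous_hPoisson_right hsn
  have hint : ∀ {g : EuclideanSpace ℝ (Fin n) → ℝ}, IsHHarmonic g →
      Integrable (fun η : sphere (0 : EuclideanSpace ℝ (Fin n)) 1 =>
        g (r • (η : EuclideanSpace ℝ (Fin n))) * hPoisson (s • (ζ : EuclideanSpace ℝ (Fin n))) η)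
        (normalizedSphereMeasure n) ∧
      Integrable (fun η : sphere (0 : EuclideanSpace ℝ (Fin n)) 1 =>
        g (s • (η : EuclideanSpace ℝ (Fin n))) * hPoisson (r • (ζ : EuclideanSpace ℝ (Fin n))) η)
        (normalizedSphereMeasure n) := fun hg =>
    ⟨((hg.contDiffOn.continuous_smul_sphere hra).mul hPs).integrable_of_compactSpace _,
      ((hg.contDiffOn.continuous_smul_sphere hsa).mul hPr).integrable_of_compactSpace _⟩
  have hspan : ∀ g ∈ Submodule.span ℝ (range (hPoissonSphere (n := n) R hRa)),
      ∃ G : EuclideanSpace ℝ (Fin n) → ℝ, IsHHarmonic G ∧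
        (∀ η : sphere (0 : EuclideanSpace ℝ (Fin n)) 1,
          G (R • (η : EuclideanSpace ℝ (Fin n))) = g η) ∧
        ∫ η : sphere (0 : EuclideanSpace ℝ (Fin n)) 1, G (r • (η : EuclideanSpace ℝ (Fin n))) *
            hPoisson (s • (ζ : EuclideanSpace ℝ (Fin n))) η ∂(normalizedSphereMeasure n) =
          ∫ η : sphere (0 : EuclideanSpace ℝ (Fin n)) 1, G (s • (η : EuclideanSpace ℝ (Fin n))) *
            hPoisson (r • (ζ : EuclideanSpace ℝ (Fin n))) η ∂(normalizedSphereMeasure n) := by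
    intro g hg
    induction hg using Submodule.span_induction with
    | mem g hg =>
      obtain ⟨ω, rfl⟩ := hg
      refine ⟨fun x => hPoisson x ω, isHHarmonic_hPoisson (by omega) (norm_coe_sphere ω),
        fun η => rfl, ?_⟩
      -- For P(·,ω) the two sides are K(rω,sζ) and K(sω,rζ).
      have h := szegoKernel_smul_swap r s ω ζ
      simp only [szegoKernel] at h
      simpa only [hPoisson_smul_comm (norm_coe_sphere _) (norm_coe_sphere ω)] using h
    | zero => exact ⟨fun _ => 0, isHHarmonic_const 0, fun η => rfl, by simp⟩
    | add g₁ g₂ _ _ h₁ h₂ =>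
      obtain ⟨G₁, hG₁, hv₁, hi₁⟩ := h₁
      obtain ⟨G₂, hG₂, hv₂, hi₂⟩ := h₂
      refine ⟨_, hG₁.add hG₂, fun η => by rw [hv₁, hv₂]; rfl, ?_⟩
      simp only [add_mul]
      rw [integral_add (hint hG₁).1 (hint hG₂).1, integral_add (hint hG₁).2 (hint hG₂).2, hi₁, hi₂]
    | smul c g _ h =>
      obtain ⟨G, hG, hv, hi⟩ := h
      refine ⟨_, hG.const_mul c, fun η => by rw [hv]; rfl, ?_⟩
      simp only [mul_assoc]
      rw [integral_const_mul, integral_const_mul, hi]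
  rw [← sub_eq_zero, ← abs_nonpos_iff]
  refine le_of_forall_pos_le_add fun ε hε => ?_
  obtain ⟨g, hg, hdist⟩ := Metric.mem_closure_iff.mp (mem_closure_span_hPoissonSphere hn.le hR0 hRa
    ⟨_, hf.contDiffOn.continuous_smul_sphere hRa⟩) (ε / 2) (by positivity)
  obtain ⟨G, hG, hv, hi⟩ := hspan g hg
  have hclose : ∀ x : EuclideanSpace ℝ (Fin n), ‖x‖ ≤ R → |f x - G x| ≤ ε / 2 := by
    intro x hx
    refine hf.abs_sub_le_of_sphere hn hG hR1 (fun y hy => ?_) hx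
    have hy0 : ‖y‖ ≠ 0 := by rw [hy]; exact hR0.ne'
    obtain ⟨η, rfl⟩ : ∃ η : sphere (0 : EuclideanSpace ℝ (Fin n)) 1,
        R • (η : EuclideanSpace ℝ (Fin n)) = y := by
      refine ⟨⟨R⁻¹ • y, ?_⟩, ?_⟩
      · rw [mem_sphere_zero_iff_norm, norm_smul, hy, norm_inv, Real.norm_of_nonneg hR0.le,
          inv_mul_cancel₀ hR0.ne']
      · simp [smul_smul, hR0.ne']
    have := (ContinuousMap.dist_apply_le_dist η).trans hdist.le
    rwa [Real.dist_eq, ← hv] at this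
  have h1 := abs_integral_mul_hPoisson_le hn (u := fun η =>
    f (r • (η : EuclideanSpace ℝ (Fin n))) - G (r • (η : EuclideanSpace ℝ (Fin n)))) (fun η =>
    hclose _ (by rw [norm_smul_sphere, abs_of_pos hr0]; exact le_max_left _ _)) hsn
  have h2 := abs_integral_mul_hPoisson_le hn (u := fun η =>
    f (s • (η : EuclideanSpace ℝ (Fin n))) - G (s • (η : EuclideanSpace ℝ (Fin n)))) (fun η =>
    hclose _ (by rw [norm_smul_sphere, abs_of_nonneg hs0]; exact le_max_right _ _)) hrn
  simp only [sub_mul] at h1 h2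
  rw [integral_sub (hint hf).1 (hint hG).1] at h1
  rw [integral_sub (hint hf).2 (hint hG).2] at h2
  rw [abs_le] at h1 h2 ⊢
  constructor <;> linarith

theorem exists_sphere_smul_eq {n : ℕ} (hn : 0 < n) (x : EuclideanSpace ℝ (Fin n)) :
    ∃ ξ : sphere (0 : EuclideanSpace ℝ (Fin n)) 1, x = ‖x‖ • (ξ : EuclideanSpace ℝ (Fin n)) := by
  rcases eq_or_ne x 0 with rfl | hx
  · exact ⟨⟨EuclideanSpace.basisFun (Fin n) ℝ ⟨0, hn⟩, by simp⟩, by simp⟩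
  · have hx' : ‖x‖ ≠ 0 := norm_ne_zero_iff.mpr hx
    exact ⟨⟨‖x‖⁻¹ • x, by simp [norm_smul, hx']⟩, by simp [smul_smul, hx']⟩

/-- Write K(sξ,rη) = K(rξ,sη) as an integral over ζ and exchange the integrals; the inner one is
then P_s f_r(ζ) = P_r f_s(ζ). The radius r thus leaves f, and only Poisson integrals of the fixed
function f_s remain. -/
theorem IsHHarmonic.integral_mul_szegoKernel {n : ℕ} (hn : 2 < n)
    {f : EuclideanSpace ℝ (Fin n) → ℝ} (hf : IsHHarmonic f) {r s : ℝ} (hr0 : 0 < r) (hr : r < 1)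
    (hs0 : 0 ≤ s) (hs : s < 1) (ξ : sphere (0 : EuclideanSpace ℝ (Fin n)) 1) :
    ∫ η : sphere (0 : EuclideanSpace ℝ (Fin n)) 1, f (r • (η : EuclideanSpace ℝ (Fin n))) *
        szegoKernel (s • (ξ : EuclideanSpace ℝ (Fin n))) (r • (η : EuclideanSpace ℝ (Fin n)))
          ∂(normalizedSphereMeasure n) =
      ∫ ζ : sphere (0 : EuclideanSpace ℝ (Fin n)) 1,
        (∫ η : sphere (0 : EuclideanSpace ℝ (Fin n)) 1, f (s • (η : EuclideanSpace ℝ (Fin n))) *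
          hPoisson (r • (ζ : EuclideanSpace ℝ (Fin n))) η ∂(normalizedSphereMeasure n)) *
        hPoisson (r • (ξ : EuclideanSpace ℝ (Fin n))) ζ ∂(normalizedSphereMeasure n) := by
  have hra : |r| < 1 := by rwa [abs_of_pos hr0]
  have hsa : |s| < 1 := by rwa [abs_of_nonneg hs0]
  have hrn : ‖r • (ξ : EuclideanSpace ℝ (Fin n))‖ < 1 := by rwa [norm_smul_sphere]
  set Φ : sphere (0 : EuclideanSpace ℝ (Fin n)) 1 → sphere (0 : EuclideanSpace ℝ (Fin n)) 1 → ℝ :=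
    fun η ζ => f (r • (η : EuclideanSpace ℝ (Fin n))) *
      (hPoisson (r • (ξ : EuclideanSpace ℝ (Fin n))) ζ *
        hPoisson (s • (η : EuclideanSpace ℝ (Fin n))) ζ) with hΦ
  have hcont : Continuous (Function.uncurry Φ) := by
    have h1 := (hf.contDiffOn.continuous_smul_sphere hra).comp
      (continuous_fst (Y := sphere (0 : EuclideanSpace ℝ (Fin n)) 1))
    have h2 := (continuous_hPoisson_right hrn).comp
      (continuous_snd (X := sphere (0 : EuclideanSpace ℝ (Fin n)) 1))
    have h3 : Continuous fun p : sphere (0 : EuclideanSpace ℝ (Fin n)) 1 ×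
        sphere (0 : EuclideanSpace ℝ (Fin n)) 1 =>
        hPoisson (s • (p.1 : EuclideanSpace ℝ (Fin n))) p.2 :=
      contDiffOn_hPoisson_prod.continuousOn.comp_continuous
        (f := fun p : sphere (0 : EuclideanSpace ℝ (Fin n)) 1 ×
          sphere (0 : EuclideanSpace ℝ (Fin n)) 1 =>
          (s • (p.1 : EuclideanSpace ℝ (Fin n)), (p.2 : EuclideanSpace ℝ (Fin n))))
        (by fun_prop) fun p => sub_ne_zero_of_norm_lt
          (by rwa [norm_smul_sphere]) (norm_coe_sphere p.2)
    exact h1.mul (h2.mul h3)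
  calc _ = ∫ η, ∫ ζ, Φ η ζ ∂(normalizedSphereMeasure n) ∂(normalizedSphereMeasure n) := by
        refine integral_congr_ae (ae_of_all _ fun η => ?_)
        simp only [hΦ]
        rw [integral_const_mul, szegoKernel_smul_swap s r ξ η, szegoKernel]
    _ = ∫ ζ, ∫ η, Φ η ζ ∂(normalizedSphereMeasure n) ∂(normalizedSphereMeasure n) :=
        integral_integral_swap (hcont.integrable_of_compactSpace _)
    _ = _ := by
        refine integral_congr_ae (ae_of_all _ fun ζ => ?_)
        simp only
        rw [← hf.integral_smul_mul_hPoisson_comm hn hr0 hr hs0 hs ζ, ← integral_mul_const]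
        refine integral_congr_ae (ae_of_all _ fun η => ?_)
        simp only [hΦ]
        rw [hPoisson_smul_comm (norm_coe_sphere η) (norm_coe_sphere ζ)]
        ring

theorem IsHHarmonic.tendsto_integral_mul_szegoKernel {n : ℕ} (hn : 2 < n)
    {f : EuclideanSpace ℝ (Fin n) → ℝ} (hf : IsHHarmonic f) {x : EuclideanSpace ℝ (Fin n)}
    (hx : ‖x‖ < 1) :
    Tendsto (fun r : ℝ => ∫ η : sphere (0 : EuclideanSpace ℝ (Fin n)) 1,
      f (r • (η : EuclideanSpace ℝ (Fin n))) *
        szegoKernel x (r • (η : EuclideanSpace ℝ (Fin n))) ∂(normalizedSphereMeasure n))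
      (𝓝[<] 1) (𝓝 (f x)) := by
  obtain ⟨ξ, hξ⟩ := exists_sphere_smul_eq (by omega : 0 < n) x
  set s := ‖x‖
  have hs0 : 0 ≤ s := norm_nonneg x
  have hsa : |s| < 1 := by rwa [abs_of_nonneg hs0]
  rw [hξ]
  have hfs := hf.contDiffOn.continuous_smul_sphere hsa
  refine Metric.tendsto_nhds.mpr fun ε hε => ?_
  have hev1 : ∀ᶠ r : ℝ in 𝓝[<] 1, r < 1 := eventually_mem_nhdsWithin
  have hev2 : ∀ᶠ r : ℝ in 𝓝[<] 1, 0 < r := nhdsWithin_le_nhds (lt_mem_nhds one_pos)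
  filter_upwards [eventually_abs_integral_hPoisson_sub_le hn hfs (ε := ε / 3) (by positivity),
    hev1, hev2] with r hA hr hr0
  have hra : |r| < 1 := by rwa [abs_of_pos hr0]
  have hrn : ‖r • (ξ : EuclideanSpace ℝ (Fin n))‖ < 1 := by rwa [norm_smul_sphere]
  rw [hf.integral_mul_szegoKernel hn hr0 hr hs0 hx ξ, Real.dist_eq]
  -- P_r is a contraction for the sup norm, so P_r(P_r f_s - f_s) is at most ε/3; together with `h2`
  -- this gives a total error of 2ε/3.
  have h1 := abs_integral_mul_hPoisson_le hn hA hrn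
  have h2 := hA ξ
  have hAc := (isHHarmonic_integral_hPoisson (by omega) hfs).contDiffOn.continuous_smul_sphere hra
  rw [integral_sub_mul_hPoisson hAc hfs hrn] at h1
  rw [abs_le] at h1 h2
  rw [abs_lt]
  constructor <;> linarith

/-- K(x,·) is the Poisson integral of the bounded function P(x,·). -/
theorem exists_abs_szegoKernel_le {n : ℕ} (hn : 2 < n) {x : EuclideanSpace ℝ (Fin n)}
    (hx : ‖x‖ < 1) :
    ∃ C : ℝ, ∀ y : EuclideanSpace ℝ (Fin n), ‖y‖ < 1 → |szegoKernel x y| ≤ C := by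
  obtain ⟨C, hC⟩ := isCompact_univ.exists_bound_of_continuousOn
    (continuous_hPoisson_right hx).continuousOn
  exact ⟨C, fun y hy => abs_integral_mul_hPoisson_le hn (fun ζ => hC ζ (mem_univ ζ)) hy⟩

theorem memHHardy_szegoKernel {𝕜 : Type*} [RCLike 𝕜] {n : ℕ} (hn : 2 < n)
    {x : EuclideanSpace ℝ (Fin n)} (hx : ‖x‖ < 1) :
    MemHHardy 2 (fun y => ((szegoKernel x y : ℝ) : 𝕜)) where
  isHHarmonic := (isHHarmonic_szegoKernel (by omega) hx).clm_comp (RCLike.ofRealCLM (K := 𝕜))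
  hardyNorm_lt_top := by
    have := isProbabilityMeasure_normalizedSphereMeasure (n := n) (by omega)
    obtain ⟨C, hC⟩ := exists_abs_szegoKernel_le hn hx
    refine lt_of_le_of_lt (iSup₂_le fun r hr => ?_) (ENNReal.ofReal_lt_top (r := C))
    have hbound : ∀ η : sphere (0 : EuclideanSpace ℝ (Fin n)) 1,
        ‖((szegoKernel x (r • (η : EuclideanSpace ℝ (Fin n))) : ℝ) : 𝕜)‖ ≤ C := fun η => by
      rw [RCLike.norm_ofReal]
      exact hC _ (by rw [norm_smul_sphere, abs_of_pos hr.1]; exact hr.2)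
    simpa using eLpNorm_le_of_ae_bound (p := 2) (μ := normalizedSphereMeasure n)
      (ae_of_all _ hbound)

theorem isSzegoKernel_szegoKernel {𝕜 : Type*} [RCLike 𝕜] {n : ℕ} (hn : 2 < n) :
    IsSzegoKernel (fun x y : EuclideanSpace ℝ (Fin n) => ((szegoKernel x y : ℝ) : 𝕜)) where
  memHHardy x hx := memHHardy_szegoKernel hn (mem_ball_zero_iff.mp hx)
  isHHarmonic_left y hy := by
    simp only [szegoKernel_comm _ y]
    exact (memHHardy_szegoKernel hn (mem_ball_zero_iff.mp hy)).isHHarmonic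
  reproducing f hf x hx := by
    have hx' := mem_ball_zero_iff.mp hx
    have hre : IsHHarmonic fun y => RCLike.re (f y) :=
      hf.isHHarmonic.clm_comp (RCLike.reCLM (K := 𝕜))
    have him : IsHHarmonic fun y => RCLike.im (f y) :=
      hf.isHHarmonic.clm_comp (RCLike.imCLM (K := 𝕜))
    have h1 := hre.tendsto_integral_mul_szegoKernel hn hx'
    have h2 := him.tendsto_integral_mul_szegoKernel hn hx'
    have h3 := ((RCLike.continuous_ofReal (K := 𝕜)).tendsto _ |>.comp h1).add
      (((RCLike.continuous_ofReal (K := 𝕜)).tendsto _ |>.comp h2).mul_const RCLike.I)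
    rw [RCLike.re_add_im] at h3
    refine h3.congr' ?_
    have hev1 : ∀ᶠ r : ℝ in 𝓝[<] 1, r < 1 := eventually_mem_nhdsWithin
    have hev2 : ∀ᶠ r : ℝ in 𝓝[<] 1, 0 < r := nhdsWithin_le_nhds (lt_mem_nhds one_pos)
    filter_upwards [hev1, hev2] with r hr hr0
    have hra : |r| < 1 := by rwa [abs_of_pos hr0]
    have hK := (isHHarmonic_szegoKernel (by omega) hx').contDiffOn.continuous_smul_sphere hra
    have hint : ∀ {g : EuclideanSpace ℝ (Fin n) → ℝ}, IsHHarmonic g →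
        Integrable (fun η : sphere (0 : EuclideanSpace ℝ (Fin n)) 1 =>
          (((g (r • (η : EuclideanSpace ℝ (Fin n))) *
            szegoKernel x (r • (η : EuclideanSpace ℝ (Fin n))) : ℝ)) : 𝕜))
          (normalizedSphereMeasure n) := fun hg =>
      (((hg.contDiffOn.continuous_smul_sphere hra).mul hK).integrable_of_compactSpace _).ofReal
    simp only [Function.comp_apply]
    rw [← integral_ofReal, ← integral_ofReal, ← integral_mul_const, ← integral_add (hint hre)
      ((hint him).mul_const _)]
    refine integral_congr_ae (ae_of_all _ fun η => ?_)
    simp only [RCLike.ofReal_mul]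
    conv_rhs => rw [← RCLike.re_add_im (f (r • (η : EuclideanSpace ℝ (Fin n))))]
    ring

/-- Each kernel reproduces the slice of the other, and both limits are of the same integral. The
pairing is bilinear, so no conjugate appears. -/
theorem IsSzegoKernel.apply_eq_swap {𝕜 : Type*} [RCLike 𝕜] {n : ℕ}
    {K K' : EuclideanSpace ℝ (Fin n) → EuclideanSpace ℝ (Fin n) → 𝕜} (hK : IsSzegoKernel K)
    (hK' : IsSzegoKernel K') {x y : EuclideanSpace ℝ (Fin n)}
    (hx : x ∈ ball (0 : EuclideanSpace ℝ (Fin n)) 1)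
    (hy : y ∈ ball (0 : EuclideanSpace ℝ (Fin n)) 1) : K x y = K' y x := by
  have h1 := hK'.reproducing _ (hK.memHHardy x hx) y hy
  have h2 := hK.reproducing _ (hK'.memHHardy y hy) x hx
  simp only [mul_comm (K' y _)] at h2
  exact tendsto_nhds_unique h1 h2

/-! ### Mixed moments of two linear forms on the sphere -/

/-- The triples `(p, q, l)` with `2p + q = j` and `2l + q = k`. -/
def extonFiber (j k : ℕ) : Finset (ℕ × ℕ × ℕ) :=
  (Finset.range (j + 1) ×ˢ Finset.range (j + 1) ×ˢ Finset.range (k + 1)).filter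
    fun t => 2 * t.1 + t.2.1 = j ∧ 2 * t.2.2 + t.2.1 = k

theorem mem_extonFiber {j k : ℕ} {t : ℕ × ℕ × ℕ} :
    t ∈ extonFiber j k ↔ 2 * t.1 + t.2.1 = j ∧ 2 * t.2.2 + t.2.1 = k := by
  simp only [extonFiber, Finset.mem_filter, Finset.mem_product, Finset.mem_range]
  omega

theorem trinomial_expansion (a b d : ℝ) (N : ℕ) :
    (a + b + d) ^ N = ∑ x ∈ Finset.HasAntidiagonal.antidiagonal N, ∑ y ∈ Finset.HasAntidiagonal.antidiagonal x.2,
      (N.factorial : ℝ) / (x.1.factorial * y.1.factorial * y.2.factorial) *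
        (a ^ x.1 * b ^ y.1 * d ^ y.2) := by
  rw [add_assoc, (Commute.all _ _).add_pow']
  refine Finset.sum_congr rfl fun x hx => ?_
  rw [(Commute.all _ _).add_pow', Finset.mul_sum, Finset.smul_sum]
  refine Finset.sum_congr rfl fun y hy => ?_
  rw [Finset.HasAntidiagonal.mem_antidiagonal] at hx hy
  rw [← hx, nsmul_eq_mul, nsmul_eq_mul, Nat.cast_add_choose]
  have h2 : ((x.2.choose y.1 : ℕ) : ℝ) = x.2.factorial / (y.1.factorial * y.2.factorial) := by
    rw [← hy, Nat.cast_add_choose]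
  rw [h2]
  field_simp

/-- Compare coefficients of t^k: the trinomial exponents satisfy p+q+l = N and q+2l = k, that is,
2p+q = 2N-k and 2l+q = k. -/
theorem coeff_of_trinomial_identity {A B D c : ℝ} {N : ℕ} {m : ℕ → ℝ}
    (h : ∀ t : ℝ, ∑ b ∈ Finset.range (2 * N + 1), m b * t ^ b =
      c * (A + t * B + t ^ 2 * D) ^ N) {k : ℕ} (hk : k ≤ 2 * N) :
    m k = c * ∑ t ∈ extonFiber (2 * N - k) k,
      (N.factorial : ℝ) / (t.1.factorial * t.2.1.factorial * t.2.2.factorial) *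
        (A ^ t.1 * B ^ t.2.1 * D ^ t.2.2) := by
  have hpoly : ∑ b ∈ Finset.range (2 * N + 1), Polynomial.monomial b (m b) =
      ∑ x ∈ Finset.HasAntidiagonal.antidiagonal N, ∑ y ∈ Finset.HasAntidiagonal.antidiagonal x.2,
        Polynomial.monomial (y.1 + 2 * y.2)
          (c * ((N.factorial : ℝ) / (x.1.factorial * y.1.factorial * y.2.factorial) *
            (A ^ x.1 * B ^ y.1 * D ^ y.2))) := by
    refine Polynomial.funext fun t => ?_
    simp only [Polynomial.eval_finsetSum, Polynomial.eval_monomial]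
    rw [h t, trinomial_expansion, Finset.mul_sum]
    refine Finset.sum_congr rfl fun x _ => ?_
    rw [Finset.mul_sum]
    refine Finset.sum_congr rfl fun y _ => ?_
    ring
  have hcoeff := congrArg (fun p => Polynomial.coeff p k) hpoly
  simp only [Polynomial.finsetSum_coeff, Polynomial.coeff_monomial] at hcoeff
  rw [Finset.sum_ite_eq' (Finset.range (2 * N + 1)) k,
    if_pos (Finset.mem_range.mpr (by omega))] at hcoeff
  rw [hcoeff, Finset.sum_sigma', ← Finset.sum_filter, Finset.mul_sum]
  refine Finset.sum_nbij' (fun s => (s.1.1, s.2.1, s.2.2))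
    (fun t => ⟨(t.1, t.2.1 + t.2.2), (t.2.1, t.2.2)⟩) ?_ ?_ ?_ ?_ ?_
  · rintro ⟨⟨p, m⟩, ⟨q, l⟩⟩ hs
    simp only [Finset.mem_filter, Finset.mem_sigma, Finset.HasAntidiagonal.mem_antidiagonal] at hs
    rw [mem_extonFiber]
    simp only
    omega
  · rintro ⟨p, q, l⟩ ht
    rw [mem_extonFiber] at ht
    change 2 * p + q = 2 * N - k ∧ 2 * l + q = k at ht
    rw [Finset.mem_filter, Finset.mem_sigma, Finset.HasAntidiagonal.mem_antidiagonal,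
      Finset.HasAntidiagonal.mem_antidiagonal]
    change (p + (q + l) = N ∧ q + l = q + l) ∧ q + 2 * l = k
    omega
  · rintro ⟨⟨p, m⟩, ⟨q, l⟩⟩ hs
    simp only [Finset.mem_filter, Finset.mem_sigma, Finset.HasAntidiagonal.mem_antidiagonal] at hs
    obtain ⟨⟨-, rfl⟩, -⟩ := hs
    rfl
  · rintro ⟨p, q, l⟩ _
    rfl
  · rintro ⟨⟨p, m⟩, ⟨q, l⟩⟩ _
    rfl

/-- The moment `∫ ⟨u, ζ⟩ ^ j ⟨v, ζ⟩ ^ k dσ(ζ)`. -/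
noncomputable def sphereMoment {n : ℕ} (u v : EuclideanSpace ℝ (Fin n)) (j k : ℕ) : ℝ :=
  ∫ ζ : sphere (0 : EuclideanSpace ℝ (Fin n)) 1,
    inner ℝ u (ζ : EuclideanSpace ℝ (Fin n)) ^ j * inner ℝ v (ζ : EuclideanSpace ℝ (Fin n)) ^ k
      ∂(normalizedSphereMeasure n)

theorem continuous_sphere_inner_pow_mul {n : ℕ} (u v : EuclideanSpace ℝ (Fin n)) (j k : ℕ) :
    Continuous fun ζ : sphere (0 : EuclideanSpace ℝ (Fin n)) 1 =>
      (inner ℝ u (ζ : EuclideanSpace ℝ (Fin n)) ^ j *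
        inner ℝ v (ζ : EuclideanSpace ℝ (Fin n)) ^ k : ℝ) := by
  fun_prop

theorem integral_inner_pow_eq {n : ℕ} {e : EuclideanSpace ℝ (Fin n)} (he : ‖e‖ = 1)
    (w : EuclideanSpace ℝ (Fin n)) (M : ℕ) :
    ∫ ζ : sphere (0 : EuclideanSpace ℝ (Fin n)) 1,
        (inner ℝ w (ζ : EuclideanSpace ℝ (Fin n)) : ℝ) ^ M ∂(normalizedSphereMeasure n) =
      ‖w‖ ^ M * ∫ ζ : sphere (0 : EuclideanSpace ℝ (Fin n)) 1,
        (inner ℝ e (ζ : EuclideanSpace ℝ (Fin n)) : ℝ) ^ M ∂(normalizedSphereMeasure n) := by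
  have hnorm : ‖w‖ = ‖‖w‖ • e‖ := by rw [norm_smul, norm_norm, he, mul_one]
  obtain ⟨T, hT, hT'⟩ := exists_linearIsometryEquiv_swap hnorm
  rw [← integral_sphere_comp T (fun ζ => (inner ℝ w ζ : ℝ) ^ M), ← integral_const_mul]
  refine integral_congr_ae (ae_of_all _ fun ζ => ?_)
  simp only
  have h : inner ℝ w (T ζ) = ‖w‖ * inner ℝ e (ζ : EuclideanSpace ℝ (Fin n)) := by
    rw [show inner ℝ w (T ζ) = inner ℝ (T (‖w‖ • e)) (T ζ) by rw [hT'], T.inner_map_map,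
      inner_smul_left, conj_trivial]
  rw [h, mul_pow]

theorem sphereMoment_odd {n : ℕ} (u v : EuclideanSpace ℝ (Fin n)) {j k : ℕ} (h : Odd (j + k)) :
    sphereMoment u v j k = 0 := by
  have h1 := integral_sphere_comp (LinearIsometryEquiv.neg ℝ)
    (fun ζ : EuclideanSpace ℝ (Fin n) => (inner ℝ u ζ ^ j * inner ℝ v ζ ^ k : ℝ))
  have h2 : ∀ ζ : EuclideanSpace ℝ (Fin n), ((-inner ℝ u ζ) ^ j * (-inner ℝ v ζ) ^ k : ℝ) =
      -(inner ℝ u ζ ^ j * inner ℝ v ζ ^ k) := fun ζ => by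
    rw [neg_pow, neg_pow (inner ℝ v ζ)]
    have : (-1 : ℝ) ^ j * (-1) ^ k = -1 := by rw [← pow_add, h.neg_one_pow]
    linear_combination (inner ℝ u ζ ^ j * inner ℝ v ζ ^ k) * this
  simp only [LinearIsometryEquiv.coe_neg, inner_neg_right, h2] at h1
  rw [integral_neg] at h1
  rw [sphereMoment]
  linarith

theorem integral_inner_add_smul_pow {n : ℕ} (u v : EuclideanSpace ℝ (Fin n)) (t : ℝ) (M : ℕ) :
    ∫ ζ : sphere (0 : EuclideanSpace ℝ (Fin n)) 1,
        (inner ℝ (u + t • v) (ζ : EuclideanSpace ℝ (Fin n)) : ℝ) ^ M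
          ∂(normalizedSphereMeasure n) =
      ∑ b ∈ Finset.range (M + 1), (M.choose b * sphereMoment u v (M - b) b) * t ^ b := by
  have hexp : ∀ ζ : EuclideanSpace ℝ (Fin n), (inner ℝ (u + t • v) ζ : ℝ) ^ M =
      ∑ b ∈ Finset.range (M + 1),
        (M.choose b * t ^ b) * (inner ℝ u ζ ^ (M - b) * inner ℝ v ζ ^ b) := fun ζ => by
    rw [inner_add_left, inner_smul_left, add_comm, add_pow]
    refine Finset.sum_congr rfl fun b _ => ?_
    simp only [conj_trivial]
    ring
  simp only [hexp]
  rw [integral_finsetSum _ fun b _ =>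
    ((continuous_sphere_inner_pow_mul u v (M - b) b).integrable_of_compactSpace _).const_mul _]
  refine Finset.sum_congr rfl fun b _ => ?_
  rw [integral_const_mul, sphereMoment]
  ring

/-- Rotation invariance gives ∫⟨u+tv,ζ⟩^(2N) = c_N(|u|²+2t⟨u,v⟩+t²|v|²)^N; both sides are
polynomials in t whose coefficients are compared. -/
theorem choose_mul_sphereMoment {n : ℕ} {e : EuclideanSpace ℝ (Fin n)} (he : ‖e‖ = 1)
    (u v : EuclideanSpace ℝ (Fin n)) {N k : ℕ} (hk : k ≤ 2 * N) :
    (2 * N).choose k * sphereMoment u v (2 * N - k) k =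
      sphereMoment e e (2 * N) 0 * ∑ t ∈ extonFiber (2 * N - k) k,
        (N.factorial : ℝ) / (t.1.factorial * t.2.1.factorial * t.2.2.factorial) *
          ((‖u‖ ^ 2) ^ t.1 * (2 * inner ℝ u v) ^ t.2.1 * (‖v‖ ^ 2) ^ t.2.2) := by
  refine coeff_of_trinomial_identity (A := ‖u‖ ^ 2) (B := 2 * inner ℝ u v) (D := ‖v‖ ^ 2)
    (m := fun k => (2 * N).choose k * sphereMoment u v (2 * N - k) k) (fun t => ?_) hk
  rw [← integral_inner_add_smul_pow, integral_inner_pow_eq he, mul_comm, pow_mul,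
    norm_add_sq_real, inner_smul_right, norm_smul, mul_pow, Real.norm_eq_abs, sq_abs]
  simp only [sphereMoment, pow_zero, mul_one]
  ring_nf

theorem sphereMoment_zero_zero {n : ℕ} (hn : 0 < n) (u v : EuclideanSpace ℝ (Fin n)) :
    sphereMoment u v 0 0 = 1 := by
  have := isProbabilityMeasure_normalizedSphereMeasure hn
  simp [sphereMoment]

/-- Multiply ζ_{i₀}^(2N) by Σ_i ζ_i² = 1 and integrate. The diagonal term is c, and each of the n-1
others is c/(2N+1) by `choose_mul_sphereMoment` for an orthonormal pair. -/
theorem sphereMoment_recursion {n : ℕ} (i₀ : Fin n) (N : ℕ) :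
    (2 * N + n : ℝ) * sphereMoment (EuclideanSpace.basisFun (Fin n) ℝ i₀)
        (EuclideanSpace.basisFun (Fin n) ℝ i₀) (2 * (N + 1)) 0 =
      (2 * N + 1) * sphereMoment (EuclideanSpace.basisFun (Fin n) ℝ i₀)
        (EuclideanSpace.basisFun (Fin n) ℝ i₀) (2 * N) 0 := by
  set e := EuclideanSpace.basisFun (Fin n) ℝ with he
  have hnorm : ∀ i, ‖e i‖ = 1 := fun i => e.norm_eq_one i
  set c := sphereMoment (e i₀) (e i₀) (2 * (N + 1)) 0 with hc
  have hsum : ∑ i, sphereMoment (e i₀) (e i) (2 * N) 2 = sphereMoment (e i₀) (e i₀) (2 * N) 0 := by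
    simp only [sphereMoment]
    rw [← integral_finsetSum _ fun i _ =>
      (continuous_sphere_inner_pow_mul (e i₀) (e i) (2 * N) 2).integrable_of_compactSpace _]
    refine integral_congr_ae (ae_of_all _ fun ζ => ?_)
    simp only
    have h1 : ∑ i, (inner ℝ (e i) (ζ : EuclideanSpace ℝ (Fin n)) : ℝ) ^ 2 = 1 := by
      have := e.sum_sq_norm_inner_right (ζ : EuclideanSpace ℝ (Fin n))
      simpa [norm_coe_sphere] using this
    rw [← Finset.mul_sum, h1, pow_zero]
  have hdiag : sphereMoment (e i₀) (e i₀) (2 * N) 2 = c := by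
    simp only [hc, sphereMoment, ← pow_add]
    rfl
  have hoff : ∀ i, i ≠ i₀ → (2 * N + 1) * sphereMoment (e i₀) (e i) (2 * N) 2 = c := fun i hi => by
    have h := choose_mul_sphereMoment (hnorm i₀) (e i₀) (e i) (N := N + 1) (k := 2) (by omega)
    -- Orthogonality kills every triple with q > 0, leaving only (N,0,1).
    rw [show 2 * (N + 1) - 2 = 2 * N by omega, e.inner_eq_zero hi.symm, mul_zero,
      Finset.sum_eq_single (N, 0, 1)] at h
    · simp only [hnorm] at h
      rw [Nat.cast_choose_two, Nat.factorial_succ] at h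
      push_cast at h
      have hf : (N.factorial : ℝ) ≠ 0 := by positivity
      rw [← hc] at h
      have hN : (N + 1 : ℝ) ≠ 0 := by positivity
      simp only [Nat.factorial_zero, Nat.factorial_one, Nat.cast_one, one_pow, mul_one, pow_zero]
        at h
      rw [mul_div_cancel_right₀ _ hf] at h
      apply mul_left_cancel₀ hN
      linarith
    · rintro ⟨p, q, l⟩ ht hne
      rw [mem_extonFiber] at ht
      have hq : q ≠ 0 := by
        rintro rfl
        apply hne
        simp only [Prod.mk.injEq]
        change 2 * p + 0 = 2 * N ∧ 2 * l + 0 = 2 at ht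
        exact ⟨by omega, trivial, by omega⟩
      simp [hq]
    · intro hmem
      exact absurd (mem_extonFiber.mpr ⟨by simp, by simp⟩) hmem
  have h2 := Finset.add_sum_erase Finset.univ (fun i => sphereMoment (e i₀) (e i) (2 * N) 2)
    (Finset.mem_univ i₀)
  have h3 : (2 * N + 1) * ∑ i ∈ Finset.univ.erase i₀, sphereMoment (e i₀) (e i) (2 * N) 2 =
      (n - 1) * c := by
    rw [Finset.mul_sum, Finset.sum_congr rfl fun i hi => hoff i (Finset.ne_of_mem_erase hi),
      Finset.sum_const, Finset.card_erase_of_mem (Finset.mem_univ _), Finset.card_univ,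
      Fintype.card_fin, nsmul_eq_mul, Nat.cast_pred i₀.pos]
  rw [hdiag, hsum] at h2
  linear_combination (2 * N + 1) * h2 - h3

theorem pochhammerSymbol_succ (a : ℝ) (m : ℕ) :
    pochhammerSymbol a (m + 1) = pochhammerSymbol a m * (a + m) := by
  simp [pochhammerSymbol, ascPochhammer_succ_eval]

theorem pochhammerSymbol_pos {a : ℝ} (ha : 0 < a) (m : ℕ) : 0 < pochhammerSymbol a m :=
  ascPochhammer_pos m a ha

theorem sphereMoment_even {n : ℕ} (i₀ : Fin n) (N : ℕ) :
    sphereMoment (EuclideanSpace.basisFun (Fin n) ℝ i₀) (EuclideanSpace.basisFun (Fin n) ℝ i₀)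
        (2 * N) 0 * (N.factorial * 4 ^ N * pochhammerSymbol (n / 2) N) = (2 * N).factorial := by
  induction N with
  | zero => simp [sphereMoment_zero_zero i₀.pos, pochhammerSymbol]
  | succ N ih =>
    have h := sphereMoment_recursion i₀ N
    rw [pochhammerSymbol_succ, Nat.factorial_succ N, show 2 * (N + 1) = 2 * N + 1 + 1 by ring,
      Nat.factorial_succ, Nat.factorial_succ, ← show 2 * (N + 1) = 2 * N + 1 + 1 by ring]
    push_cast
    rw [← ih]
    linear_combination (2 * (N + 1) * N.factorial * 4 ^ N * pochhammerSymbol (n / 2) N : ℝ) * h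

/-- The mixed moments of two linear forms on the sphere. -/
theorem sphereMoment_eq {n : ℕ} (hn : 0 < n) (u v : EuclideanSpace ℝ (Fin n)) (j k : ℕ) :
    sphereMoment u v j k = j.factorial * k.factorial * ∑ t ∈ extonFiber j k,
      (‖u‖ / 2) ^ (2 * t.1) * (inner ℝ u v / 2) ^ t.2.1 * (‖v‖ / 2) ^ (2 * t.2.2) /
        (pochhammerSymbol (n / 2) (t.1 + t.2.1 + t.2.2) *
          t.1.factorial * t.2.1.factorial * t.2.2.factorial) := by
  rcases Nat.even_or_odd (j + k) with he | ho
  · obtain ⟨N, hN⟩ := he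
    have hj : j = 2 * N - k := by omega
    have hk : k ≤ 2 * N := by omega
    have h := choose_mul_sphereMoment
      ((EuclideanSpace.basisFun (Fin n) ℝ).norm_eq_one ⟨0, hn⟩) u v hk
    have hc := sphereMoment_even (n := n) ⟨0, hn⟩ N
    have hpos : 0 < pochhammerSymbol ((n : ℝ) / 2) N := pochhammerSymbol_pos (by positivity) N
    have hfac : ((2 * N).choose k : ℝ) * (k.factorial * j.factorial) = (2 * N).factorial := by
      rw [hj, ← mul_assoc]
      exact_mod_cast Nat.choose_mul_factorial_mul_factorial hk
    rw [← hj] at h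
    have hch : ((2 * N).choose k : ℝ) ≠ 0 := by exact_mod_cast (Nat.choose_pos hk).ne'
    apply mul_left_cancel₀ hch
    rw [h, ← mul_assoc, mul_comm (j.factorial : ℝ), hfac, ← hc, Finset.mul_sum, Finset.mul_sum]
    refine Finset.sum_congr rfl fun t ht => ?_
    obtain ⟨h1, h2⟩ := mem_extonFiber.mp ht
    have hsum : t.1 + t.2.1 + t.2.2 = N := by omega
    rw [hsum]
    have h4 : (4 : ℝ) ^ N = 4 ^ t.1 * 4 ^ t.2.1 * 4 ^ t.2.2 := by rw [← pow_add, ← pow_add, hsum]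
    have hu : (‖u‖ ^ 2) ^ t.1 = 4 ^ t.1 * (‖u‖ / 2) ^ (2 * t.1) := by
      rw [pow_mul, ← mul_pow]; ring_nf
    have hv : (‖v‖ ^ 2) ^ t.2.2 = 4 ^ t.2.2 * (‖v‖ / 2) ^ (2 * t.2.2) := by
      rw [pow_mul, ← mul_pow]; ring_nf
    have huv : (2 * inner ℝ u v : ℝ) ^ t.2.1 = 4 ^ t.2.1 * (inner ℝ u v / 2) ^ t.2.1 := by
      rw [← mul_pow]; ring_nf
    rw [hu, hv, huv, h4]
    field_simp
  · rw [sphereMoment_odd u v ho, Finset.sum_eq_zero, mul_zero]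
    -- The fibre is empty here, since j + k = 2(p+q+l) on it.
    intro t ht
    obtain ⟨h1, h2⟩ := mem_extonFiber.mp ht
    obtain ⟨M, hM⟩ := ho
    omega

/-! ### Summation of the kernel to Exton's series -/

theorem factorial_mul_choose_eq_pochhammerSymbol {n : ℕ} (hn : 2 ≤ n) (j : ℕ) :
    (j.factorial : ℝ) * ((j + (n - 2)).choose (n - 2) : ℝ) = pochhammerSymbol ((n : ℝ) - 1) j := by
  rw [pochhammerSymbol, show (n : ℝ) - 1 = ((n - 1 : ℕ) : ℝ) by rw [Nat.cast_pred (by omega)],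
    ascPochhammer_nat_eq_natCast_ascFactorial, Nat.ascFactorial_eq_factorial_mul_choose',
    show n - 1 + j - 1 = j + (n - 2) by omega, ← Nat.choose_symm_add]
  push_cast
  rfl

/-- The terms of the series `X₉`, indexed by the fibre of `(j, k)`, add up to a moment. -/
theorem sum_extonFiber_extonX9Term {n : ℕ} (hn : 2 ≤ n) (u v : EuclideanSpace ℝ (Fin n))
    (j k : ℕ) :
    ∑ t ∈ extonFiber j k, extonX9Term ((n : ℝ) - 1) ((n : ℝ) - 1) ((n : ℝ) / 2) ((‖u‖ / 2) ^ 2)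
        (inner ℝ u v / 2) ((‖v‖ / 2) ^ 2) t.1 t.2.1 t.2.2 =
      ((j + (n - 2)).choose (n - 2) : ℝ) * ((k + (n - 2)).choose (n - 2) : ℝ) *
        sphereMoment u v j k := by
  rw [sphereMoment_eq (by omega), Finset.mul_sum, Finset.mul_sum]
  refine Finset.sum_congr rfl fun t ht => ?_
  obtain ⟨h1, h2⟩ := mem_extonFiber.mp ht
  rw [extonX9Term, h1, h2, ← factorial_mul_choose_eq_pochhammerSymbol hn,
    ← factorial_mul_choose_eq_pochhammerSymbol hn, pow_mul, pow_mul]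
  ring

theorem integral_norm_inner_pow_mul_le {n : ℕ} (hn : 0 < n) (u v : EuclideanSpace ℝ (Fin n)) (j k : ℕ) :
    ∫ ζ : sphere (0 : EuclideanSpace ℝ (Fin n)) 1,
      ‖(inner ℝ u (ζ : EuclideanSpace ℝ (Fin n)) ^ j *
        inner ℝ v (ζ : EuclideanSpace ℝ (Fin n)) ^ k : ℝ)‖ ∂(normalizedSphereMeasure n) ≤
      ‖u‖ ^ j * ‖v‖ ^ k := by
  have := isProbabilityMeasure_normalizedSphereMeasure hn
  have h := integral_mono (μ := normalizedSphereMeasure n)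
    ((continuous_sphere_inner_pow_mul u v j k).norm.integrable_of_compactSpace _)
    (integrable_const (‖u‖ ^ j * ‖v‖ ^ k)) fun ζ => by
      have hle : ∀ w : EuclideanSpace ℝ (Fin n),
          ‖(inner ℝ w (ζ : EuclideanSpace ℝ (Fin n)) : ℝ)‖ ≤ ‖w‖ := fun w => by
        simpa [norm_coe_sphere] using norm_inner_le_norm (𝕜 := ℝ) w (ζ : EuclideanSpace ℝ (Fin n))
      simp only
      rw [norm_mul, norm_pow, norm_pow]
      gcongr
      · exact hle u
      · exact hle v
  simpa using h

theorem summable_choose_mul_pow {n : ℕ} {r : ℝ} (hr0 : 0 ≤ r) (hr : r < 1) :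
    Summable fun j : ℕ => ((j + (n - 2)).choose (n - 2) : ℝ) * r ^ j :=
  (hasSum_choose_mul_geometric_of_norm_lt_one (n - 2)
    (by rwa [Real.norm_of_nonneg hr0])).summable

theorem summable_choose_mul_choose_mul_pow {n : ℕ} {r s : ℝ} (hr0 : 0 ≤ r) (hr : r < 1)
    (hs0 : 0 ≤ s) (hs : s < 1) :
    Summable fun i : ℕ × ℕ => ((i.1 + (n - 2)).choose (n - 2) : ℝ) *
      ((i.2 + (n - 2)).choose (n - 2) : ℝ) * (r ^ i.1 * s ^ i.2) := by
  refine ((summable_choose_mul_pow (n := n) hr0 hr).mul_of_nonneg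
    (summable_choose_mul_pow (n := n) hs0 hs) (fun j => ?_) fun j => ?_).congr fun i => ?_
  · exact mul_nonneg (Nat.cast_nonneg _) (pow_nonneg hr0 _)
  · exact mul_nonneg (Nat.cast_nonneg _) (pow_nonneg hs0 _)
  · ring

/-- Multiply the binomial series of the two Poisson kernels and integrate termwise; the norms of the
terms are dominated by a product of two convergent series in |u|^j and |v|^k. -/
theorem hasSum_sphereMoment_szegoKernel {n : ℕ} (hn : 2 < n) {x y : EuclideanSpace ℝ (Fin n)}
    (hx : ‖x‖ < 1) (hy : ‖y‖ < 1) :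
    HasSum (fun i : ℕ × ℕ =>
      (((1 - ‖x‖ ^ 2) / (1 + ‖x‖ ^ 2)) ^ (n - 1) * ((1 - ‖y‖ ^ 2) / (1 + ‖y‖ ^ 2)) ^ (n - 1)) *
        (((i.1 + (n - 2)).choose (n - 2) : ℝ) * ((i.2 + (n - 2)).choose (n - 2) : ℝ) *
          sphereMoment (doubleAngle x) (doubleAngle y) i.1 i.2)) (szegoKernel x y) := by
  set A := ((1 - ‖x‖ ^ 2) / (1 + ‖x‖ ^ 2)) ^ (n - 1)
  set B := ((1 - ‖y‖ ^ 2) / (1 + ‖y‖ ^ 2)) ^ (n - 1)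
  set u := doubleAngle x
  set v := doubleAngle y
  have hu : ‖u‖ < 1 := norm_doubleAngle_lt_one hx
  have hv : ‖v‖ < 1 := norm_doubleAngle_lt_one hy
  set a : ℕ → ℝ := fun j => ((j + (n - 2)).choose (n - 2) : ℝ) with ha
  set F : ℕ × ℕ → sphere (0 : EuclideanSpace ℝ (Fin n)) 1 → ℝ := fun i ζ =>
    (A * B * (a i.1 * a i.2)) * (inner ℝ u (ζ : EuclideanSpace ℝ (Fin n)) ^ i.1 *
      inner ℝ v (ζ : EuclideanSpace ℝ (Fin n)) ^ i.2) with hF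
  have hbound := summable_choose_mul_choose_mul_pow (n := n) (norm_nonneg u) hu (norm_nonneg v) hv
  have h := hasSum_integral_of_summable_integral_norm (μ := normalizedSphereMeasure n) (F := F)
    (fun i => ((continuous_sphere_inner_pow_mul u v i.1 i.2).integrable_of_compactSpace _).const_mul
      _) (by
    refine Summable.of_nonneg_of_le (fun i => integral_nonneg fun ζ => norm_nonneg _) (fun i => ?_)
      (hbound.mul_left ‖A * B‖)
    have ha0 : ‖a i.1 * a i.2‖ = a i.1 * a i.2 :=
      Real.norm_of_nonneg (mul_nonneg (Nat.cast_nonneg _) (Nat.cast_nonneg _))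
    simp only [hF, norm_mul (A * B * (a i.1 * a i.2)), norm_mul (A * B) (a i.1 * a i.2), ha0]
    rw [integral_const_mul, mul_assoc]
    have hle := integral_norm_inner_pow_mul_le (by omega : 0 < n) u v i.1 i.2
    have h0 : 0 ≤ a i.1 * a i.2 := mul_nonneg (Nat.cast_nonneg _) (Nat.cast_nonneg _)
    gcongr)
  have hval : ∀ i, ∫ ζ, F i ζ ∂(normalizedSphereMeasure n) =
      (A * B) * (a i.1 * a i.2 * sphereMoment u v i.1 i.2) := fun i => by
    simp only [hF]
    rw [integral_const_mul, sphereMoment, mul_assoc]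
  have htot : ∫ ζ, ∑' i, F i ζ ∂(normalizedSphereMeasure n) = szegoKernel x y := by
    rw [szegoKernel]
    refine integral_congr_ae (ae_of_all _ fun ζ => ?_)
    have h1 := hasSum_hPoisson hn.le hx (norm_coe_sphere ζ)
    have h2 := hasSum_hPoisson hn.le hy (norm_coe_sphere ζ)
    have h3 := tsum_mul_tsum_of_summable_norm h1.summable.norm h2.summable.norm
    rw [h1.tsum_eq, h2.tsum_eq] at h3
    simp only
    rw [h3]
    refine tsum_congr fun i => ?_
    simp only [hF, ha]
    ring
  rw [htot] at h
  simpa only [hval] using h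

theorem extonX9Term_nonneg {α β γ x y z : ℝ} (hα : 0 < α) (hβ : 0 < β) (hγ : 0 < γ) (hx : 0 ≤ x)
    (hy : 0 ≤ y) (hz : 0 ≤ z) (p q l : ℕ) : 0 ≤ extonX9Term α β γ x y z p q l := by
  have h1 := pochhammerSymbol_pos hα (2 * p + q)
  have h2 := pochhammerSymbol_pos hβ (2 * l + q)
  have h3 := pochhammerSymbol_pos hγ (p + q + l)
  unfold extonX9Term
  positivity

theorem abs_extonX9Term_le {α β γ x y y' z : ℝ} (hα : 0 < α) (hβ : 0 < β) (hγ : 0 < γ)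
    (hx : 0 ≤ x) (hy : |y| ≤ y') (hz : 0 ≤ z) (p q l : ℕ) :
    ‖extonX9Term α β γ x y z p q l‖ ≤ extonX9Term α β γ x y' z p q l := by
  have h1 := pochhammerSymbol_pos hα (2 * p + q)
  have h2 := pochhammerSymbol_pos hβ (2 * l + q)
  have h3 := pochhammerSymbol_pos hγ (p + q + l)
  have h4 : 0 ≤ pochhammerSymbol α (2 * p + q) * pochhammerSymbol β (2 * l + q) /
    (pochhammerSymbol γ (p + q + l) * p.factorial * q.factorial * l.factorial) := by positivity
  unfold extonX9Term
  rw [norm_mul, norm_mul, norm_mul, Real.norm_of_nonneg h4, norm_pow, norm_pow, norm_pow,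
    Real.norm_of_nonneg hx, Real.norm_of_nonneg hz, Real.norm_eq_abs]
  gcongr

/-- By Cauchy–Schwarz the terms are dominated by those for parallel vectors of the same lengths.
These are nonnegative, so summability may be checked after grouping into fibres, whose sums are
binomial coefficients times moments bounded by |u|^j|v|^k. -/
theorem summable_extonX9Term {n : ℕ} (hn : 2 < n) {u v : EuclideanSpace ℝ (Fin n)} (hu : ‖u‖ < 1)
    (hv : ‖v‖ < 1) :
    Summable fun t : ℕ × ℕ × ℕ => extonX9Term ((n : ℝ) - 1) ((n : ℝ) - 1) ((n : ℝ) / 2)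
      ((‖u‖ / 2) ^ 2) (inner ℝ u v / 2) ((‖v‖ / 2) ^ 2) t.1 t.2.1 t.2.2 := by
  have hn1 : (0 : ℝ) < (n : ℝ) - 1 := by
    have : (2 : ℝ) < n := by exact_mod_cast hn
    linarith
  have hn2 : (0 : ℝ) < (n : ℝ) / 2 := by positivity
  -- Any unit vector serves as the common direction.
  obtain ⟨e, -⟩ := exists_sphere_smul_eq (by omega : 0 < n) u
  set u' := ‖u‖ • (e : EuclideanSpace ℝ (Fin n)) with hu'
  set v' := ‖v‖ • (e : EuclideanSpace ℝ (Fin n)) with hv'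
  have hnu : ‖u'‖ = ‖u‖ := by rw [norm_smul_sphere, abs_norm]
  have hnv : ‖v'‖ = ‖v‖ := by rw [norm_smul_sphere, abs_norm]
  have hin : (inner ℝ u' v' : ℝ) = ‖u‖ * ‖v‖ := by
    rw [hu', hv', inner_smul_left, inner_smul_right, real_inner_self_eq_norm_sq, norm_coe_sphere]
    simp
  refine Summable.of_norm_bounded (g := fun t : ℕ × ℕ × ℕ => extonX9Term ((n : ℝ) - 1)
    ((n : ℝ) - 1) ((n : ℝ) / 2) ((‖u'‖ / 2) ^ 2) (inner ℝ u' v' / 2) ((‖v'‖ / 2) ^ 2)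
    t.1 t.2.1 t.2.2) ?_ fun t => ?_
  · rw [summable_partition (s := fun i : ℕ × ℕ => (extonFiber i.1 i.2 : Set (ℕ × ℕ × ℕ)))]
    · refine ⟨fun i => Summable.of_finite, ?_⟩
      have hfib : ∀ i : ℕ × ℕ, ∑' t : (extonFiber i.1 i.2 : Set (ℕ × ℕ × ℕ)),
          extonX9Term ((n : ℝ) - 1) ((n : ℝ) - 1) ((n : ℝ) / 2) ((‖u'‖ / 2) ^ 2)
            (inner ℝ u' v' / 2) ((‖v'‖ / 2) ^ 2) t.1.1 t.1.2.1 t.1.2.2 =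
          ((i.1 + (n - 2)).choose (n - 2) : ℝ) * ((i.2 + (n - 2)).choose (n - 2) : ℝ) *
            sphereMoment u' v' i.1 i.2 := fun i => by
        rw [← sum_extonFiber_extonX9Term hn.le]
        exact Finset.tsum_subtype (extonFiber i.1 i.2) fun t => extonX9Term ((n : ℝ) - 1)
          ((n : ℝ) - 1) ((n : ℝ) / 2) ((‖u'‖ / 2) ^ 2) (inner ℝ u' v' / 2) ((‖v'‖ / 2) ^ 2)
          t.1 t.2.1 t.2.2
      simp only [hfib]
      refine Summable.of_norm_bounded (summable_choose_mul_choose_mul_pow (n := n)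
        (norm_nonneg u') (hnu ▸ hu) (norm_nonneg v') (hnv ▸ hv)) fun i => ?_
      rw [norm_mul, Real.norm_of_nonneg (mul_nonneg (Nat.cast_nonneg _) (Nat.cast_nonneg _))]
      refine mul_le_mul_of_nonneg_left ?_ (mul_nonneg (Nat.cast_nonneg _) (Nat.cast_nonneg _))
      exact (norm_integral_le_integral_norm _).trans
        (integral_norm_inner_pow_mul_le (by omega) u' v' i.1 i.2)
    · intro t
      rw [hin]
      exact extonX9Term_nonneg hn1 hn1 hn2 (by positivity) (by positivity) (by positivity) _ _ _
    · intro t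
      refine ⟨(2 * t.1 + t.2.1, 2 * t.2.2 + t.2.1), ?_, fun i hi => ?_⟩
      · simp [mem_extonFiber]
      · obtain ⟨h1, h2⟩ := mem_extonFiber.mp hi
        exact Prod.ext h1.symm h2.symm
  · rw [hnu, hnv, hin]
    refine abs_extonX9Term_le hn1 hn1 hn2 (by positivity) ?_ (by positivity) _ _ _
    rw [abs_div, abs_two]
    have := abs_real_inner_le_norm u v
    linarith

/-- Absolute summability allows the triple series to be regrouped by (2p+q, 2l+q), which gives the
double series of moments already summed to K. -/
theorem szegoKernel_eq_extonX9 {n : ℕ} (hn : 2 < n) {x y : EuclideanSpace ℝ (Fin n)}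
    (hx : ‖x‖ < 1) (hy : ‖y‖ < 1) :
    szegoKernel x y =
      ((1 - ‖x‖ ^ 2) / (1 + ‖x‖ ^ 2)) ^ (n - 1) * ((1 - ‖y‖ ^ 2) / (1 + ‖y‖ ^ 2)) ^ (n - 1) *
        extonX9 ((n : ℝ) - 1) ((n : ℝ) - 1) ((n : ℝ) / 2) ((‖doubleAngle x‖ / 2) ^ 2)
          (inner ℝ (doubleAngle x) (doubleAngle y) / 2) ((‖doubleAngle y‖ / 2) ^ 2) := by
  have hs := summable_extonX9Term hn (norm_doubleAngle_lt_one hx) (norm_doubleAngle_lt_one hy)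
  set f : ℕ × ℕ × ℕ → ℝ := fun t => extonX9Term ((n : ℝ) - 1) ((n : ℝ) - 1) ((n : ℝ) / 2)
    ((‖doubleAngle x‖ / 2) ^ 2) (inner ℝ (doubleAngle x) (doubleAngle y) / 2)
    ((‖doubleAngle y‖ / 2) ^ 2) t.1 t.2.1 t.2.2 with hf
  have hit : extonX9 ((n : ℝ) - 1) ((n : ℝ) - 1) ((n : ℝ) / 2) ((‖doubleAngle x‖ / 2) ^ 2)
      (inner ℝ (doubleAngle x) (doubleAngle y) / 2) ((‖doubleAngle y‖ / 2) ^ 2) = ∑' t, f t := by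
    rw [hs.tsum_prod, extonX9]
    exact tsum_congr fun p => ((hs.prod_factor p).tsum_prod).symm
  have hfib := hs.hasSum.tsum_fiberwise (fun t : ℕ × ℕ × ℕ =>
    (2 * t.1 + t.2.1, 2 * t.2.2 + t.2.1))
  have hpre : ∀ i : ℕ × ℕ, (fun t : ℕ × ℕ × ℕ => (2 * t.1 + t.2.1, 2 * t.2.2 + t.2.1)) ⁻¹' {i} =
      (extonFiber i.1 i.2 : Set (ℕ × ℕ × ℕ)) := fun i => by
    ext t
    simp [mem_extonFiber, Prod.ext_iff]
  have hval : ∀ i : ℕ × ℕ, ∑' t : (fun t : ℕ × ℕ × ℕ =>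
      (2 * t.1 + t.2.1, 2 * t.2.2 + t.2.1)) ⁻¹' {i}, f t =
      ((i.1 + (n - 2)).choose (n - 2) : ℝ) * ((i.2 + (n - 2)).choose (n - 2) : ℝ) *
        sphereMoment (doubleAngle x) (doubleAngle y) i.1 i.2 := fun i => by
    rw [hpre, ← sum_extonFiber_extonX9Term hn.le]
    exact Finset.tsum_subtype (extonFiber i.1 i.2) f
  simp only [hval] at hfib
  rw [hit]
  exact (hasSum_sphereMoment_szegoKernel hn hx hy).unique (hfib.mul_left _)

theorem corollary3p2 {𝕜 : Type*} [RCLike 𝕜] (n : ℕ) (hn : 2 < n) :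
    (∃ K : EuclideanSpace ℝ (Fin n) → EuclideanSpace ℝ (Fin n) → 𝕜, IsSzegoKernel K) ∧
    ∀ K : EuclideanSpace ℝ (Fin n) → EuclideanSpace ℝ (Fin n) → 𝕜, IsSzegoKernel K →
      ∀ x ∈ ball (0 : EuclideanSpace ℝ (Fin n)) 1, ∀ y ∈ ball (0 : EuclideanSpace ℝ (Fin n)) 1,
        ∀ X Y Z : ℝ,
          X = (‖x‖ / (1 + ‖x‖ ^ 2)) ^ 2 →
          Y = 2 * inner ℝ x y / ((1 + ‖x‖ ^ 2) * (1 + ‖y‖ ^ 2)) →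
          Z = (‖y‖ / (1 + ‖y‖ ^ 2)) ^ 2 →
          Summable (fun k : ℕ × ℕ × ℕ =>
            extonX9Term ((n : ℝ) - 1) ((n : ℝ) - 1) ((n : ℝ) / 2) X Y Z k.1 k.2.1 k.2.2) ∧
          K x y = ((((1 - ‖x‖ ^ 2) ^ (n - 1) * (1 - ‖y‖ ^ 2) ^ (n - 1) /
              ((1 + ‖x‖ ^ 2) ^ (n - 1) * (1 + ‖y‖ ^ 2) ^ (n - 1)) *
            extonX9 ((n : ℝ) - 1) ((n : ℝ) - 1) ((n : ℝ) / 2) X Y Z : ℝ)) : 𝕜) := by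

  refine ⟨⟨_, isSzegoKernel_szegoKernel hn⟩, fun K hK x hx y hy X Y Z hX hY hZ => ?_⟩
  have hx' := mem_ball_zero_iff.mp hx
  have hy' := mem_ball_zero_iff.mp hy
  have hX' : X = (‖doubleAngle x‖ / 2) ^ 2 := by rw [hX, norm_doubleAngle]; ring
  have hZ' : Z = (‖doubleAngle y‖ / 2) ^ 2 := by rw [hZ, norm_doubleAngle]; ring
  have hY' : Y = inner ℝ (doubleAngle x) (doubleAngle y) / 2 := by
    rw [hY, doubleAngle, doubleAngle, inner_smul_left, inner_smul_right, conj_trivial]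
    field_simp
  rw [hX', hY', hZ']
  refine ⟨summable_extonX9Term hn (norm_doubleAngle_lt_one hx') (norm_doubleAngle_lt_one hy'), ?_⟩
  rw [hK.apply_eq_swap (isSzegoKernel_szegoKernel hn) hx hy, szegoKernel_comm,
    szegoKernel_eq_extonX9 hn hx' hy', div_pow, div_pow, div_mul_div_comm]
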